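/- Let $\mathcal V$ be a symmetric monoidal closed category whose underlying ordinary category is locally small, complete and cocomplete; "category" and "functor" mean $\mathcal V$-category and $\mathcal V$-functor, and a category is small if its isomorphism classes of objects form a small set. A weight is a functor $\phi:\mathcal K^{op}\to\mathcal V$ with $\mathcal K$ small. Let $\Phi$ be any class of weights. Write $\Phi^+$ for the class of $\Phi$-flat weights, i.e. of those weights $\phi:\mathcal L^{op}\to\mathcal V$ for which the weighted-colimit functor $\phi*-:[\mathcal L,\mathcal V]\to\mathcal V$ preserves all $\Phi$-weighted limits. For a class $\Psi$ of weights and a full subcategory $\mathcal B$ of $\mathcal A$, write $\Psi\{\mathcal B\}$ for the closure of $\mathcal B$ in $\mathcal A$ under $\Psi$-colimits, i.e. the smallest full replete subcategory of $\mathcal A$ that contains $\mathcal B$ and is closed under $\Psi$-weighted colimits formed in $\mathcal A$. For a small $\mathcal N$, write $\Psi(\mathcal N)$ for the closure of the representables in $[\mathcal N^{op},\mathcal V]$ under $\Psi$-colimits. Let $\mathcal N$ be a small category that admits all $\Phi$-weighted colimits, and let $\Phi\text{-}\mathbf{Conts}[\mathcal N^{op},\mathcal V]$ be the full subcategory of $[\mathcal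 N^{op},\mathcal V]$ on the functors $\mathcal N^{op}\to\mathcal V$ that preserve all $\Phi$-weighted limits. Then: (a) $\Phi\text{-}\mathbf{Conts}[\mathcal N^{op},\mathcal V]$ is closed in $[\mathcal N^{op},\mathcal V]$ under all (small weighted) limits and under $\Phi^+$-weighted colimits; consequently $\Phi^+(\mathcal N)\subseteq\Phi\text{-}\mathbf{Conts}[\mathcal N^{op},\mathcal V]$. (b) Every object of $[\mathcal N^{op},\mathcal V]$ that lies in $\Phi^+\{\Phi(\mathcal N)\}$, the closure of $\Phi(\mathcal N)$ in $[\mathcal N^{op},\mathcal V]$ under $\Phi^+$-colimits, has a reflection into $\Phi\text{-}\mathbf{Conts}[\mathcal N^{op},\mathcal V]$ (in the $\mathcal V$-enriched sense), and this reflection lies in $\Phi^+(\mathcal N)$. (c) The reflection into $\Phi\text{-}\mathbf{Conts}[\mathcal N^{op},\mathcal V]$ of an object of $\Phi(\mathcal N)$ is isomorphic to a representable $\mathcal N(-,n)$. -/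

import Mathlib

open CategoryTheory MonoidalCategory BraidedCategory Limits Opposite
open scoped MonoidalClosed

universe u v w u₁ u₂ u₃

noncomputable section

namespace EnrichedFlat

section Basic

variable (V : Type v) [Category.{u} V] [MonoidalCategory V]

/-- A `V`-category is small when its isomorphism classes of objects (isomorphism being taken in
the underlying ordinary category) form a small set. -/
class IsSmall (C : Type u₁) [EnrichedCategory V C] : Prop where
  small_isoClasses : Small.{u} (Quotient (isIsomorphicSetoid (ForgetEnrichment V C)))

/-- Two objects of a `V`-category are isomorphic. -/
def ObjIso {C : Type u₁} [EnrichedCategory V C] (a b : C) : Prop :=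
  Nonempty (ForgetEnrichment.of V a ≅ ForgetEnrichment.of V b)

/-- Precomposition `A(b, c) ⟶ A(a, c)` with an arrow `r : 𝟙_ V ⟶ A(a, b)`. -/
def precomp {A : Type u₁} [EnrichedCategory V A] {a b : A} (r : 𝟙_ V ⟶ (a ⟶[V] b)) (c : A) :
    (b ⟶[V] c) ⟶ (a ⟶[V] c) :=
  (λ_ _).inv ≫ r ▷ _ ≫ eComp V a b c

/-- Postcomposition `A(a, b) ⟶ A(a, c)` with an arrow `r : 𝟙_ V ⟶ A(b, c)`. -/
def postcomp {A : Type u₁} [EnrichedCategory V A] (a : A) {b c : A} (r : 𝟙_ V ⟶ (b ⟶[V] c)) :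
    (a ⟶[V] b) ⟶ (a ⟶[V] c) :=
  (ρ_ _).inv ≫ _ ◁ r ≫ eComp V a b c

variable [SymmetricCategory V]

/-- `V`-naturality (in the sense of ends) of a family `σ c : X ⟶ D(F c, G c)`. For `X = 𝟙_ V` this
is `V`-naturality of a transformation `F ⟶ G`. -/
def IsNatFamily {C : Type u₁} [EnrichedCategory V C] {D : Type u₂} [EnrichedCategory V D]
    (F G : EnrichedFunctor V C D) {X : V} (σ : ∀ c : C, X ⟶ (F.obj c ⟶[V] G.obj c)) : Prop :=
  ∀ x y : C,
    (β_ X (x ⟶[V] y)).hom ≫ (F.map x y ⊗ₘ σ y) ≫ eComp V (F.obj x) (F.obj y) (G.obj y) =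
      (σ x ⊗ₘ G.map x y) ≫ eComp V (F.obj x) (G.obj x) (G.obj y)

/-- The family `π` exhibits `E` as the end `∫ c, D(F c, G c)`, i.e. as the object of
`V`-natural transformations from `F` to `G`. -/
structure IsNatObj {C : Type u₁} [EnrichedCategory V C] {D : Type u₂} [EnrichedCategory V D]
    (F G : EnrichedFunctor V C D) (E : V) (π : ∀ c : C, E ⟶ (F.obj c ⟶[V] G.obj c)) : Prop where
  natural : IsNatFamily V F G π
  existsUnique : ∀ (X : V) (σ : ∀ c : C, X ⟶ (F.obj c ⟶[V] G.obj c)), IsNatFamily V F G σ →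
    ∃! f : X ⟶ E, ∀ c, f ≫ π c = σ c

/-- The opposite of a `V`-functor. -/
def opFunctor {C : Type u₁} [EnrichedCategory V C] {D : Type u₂} [EnrichedCategory V D]
    (F : EnrichedFunctor V C D) : EnrichedFunctor V Cᵒᵖ Dᵒᵖ where
  obj c := op (F.obj c.unop)
  map x y := F.map y.unop x.unop
  map_id x := F.map_id x.unop
  map_comp x y z := by
    have h := F.map_comp z.unop y.unop x.unop
    rw [eComp_op_eq, eComp_op_eq, Category.assoc, h]
    exact (braiding_naturality_assoc _ _ _).symm

end Basic

section Whisker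

variable {V : Type v} [Category.{u} V] [MonoidalCategory V]
variable {C : Type u₁} [EnrichedCategory V C] {D : Type u₂} [EnrichedCategory V D]

theorem precomp_inv_hom {a b : C} (e : ForgetEnrichment.of V a ≅ ForgetEnrichment.of V b) (c : C) :
    precomp V (ForgetEnrichment.homTo V e.inv) c ≫ precomp V (ForgetEnrichment.homTo V e.hom) c =
      𝟙 (a ⟶[V] c) := by
  have h := eHomWhiskerRight_comp V e.hom e.inv (ForgetEnrichment.of V c)
  rw [e.hom_inv_id, eHomWhiskerRight_id] at h
  exact h.symm

theorem postcomp_hom_inv {a b : C} (e : ForgetEnrichment.of V a ≅ ForgetEnrichment.of V b) (c : C) :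
    postcomp V c (ForgetEnrichment.homTo V e.hom) ≫ postcomp V c (ForgetEnrichment.homTo V e.inv) =
      𝟙 (c ⟶[V] a) := by
  have h := eHomWhiskerLeft_comp V (ForgetEnrichment.of V c) e.hom e.inv
  rw [e.hom_inv_id, eHomWhiskerLeft_id] at h
  exact h.symm

theorem eComp_precomp {a b : C} (r : 𝟙_ V ⟶ (a ⟶[V] b)) (y z : C) :
    eComp V b y z ≫ precomp V r z = precomp V r y ▷ _ ≫ eComp V a y z :=
  eComp_eHomWhiskerRight V (X := ForgetEnrichment.of V a) (X' := ForgetEnrichment.of V b) r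
    (ForgetEnrichment.of V y) (ForgetEnrichment.of V z)

theorem eComp_postcomp (x y : C) {a b : C} (r : 𝟙_ V ⟶ (a ⟶[V] b)) :
    eComp V x y a ≫ postcomp V x r = _ ◁ postcomp V y r ≫ eComp V x y b :=
  eComp_eHomWhiskerLeft V (ForgetEnrichment.of V x) (ForgetEnrichment.of V y)
    (Z := ForgetEnrichment.of V a) (Z' := ForgetEnrichment.of V b) r

theorem postcomp_precomp {a b x y : C} (r : 𝟙_ V ⟶ (a ⟶[V] b)) (t : 𝟙_ V ⟶ (x ⟶[V] y)) :
    postcomp V b t ≫ precomp V r y = precomp V r x ≫ postcomp V a t :=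
  eHom_whisker_exchange V (X := ForgetEnrichment.of V a) (X' := ForgetEnrichment.of V b)
    (Y := ForgetEnrichment.of V x) (Y' := ForgetEnrichment.of V y) r t

theorem postcomp_eComp (x z : C) {a b : C} (r : 𝟙_ V ⟶ (a ⟶[V] b)) :
    postcomp V x r ▷ _ ≫ eComp V x b z = _ ◁ precomp V r z ≫ eComp V x a z := by
  dsimp only [postcomp, precomp]
  simp only [comp_whiskerRight, MonoidalCategory.whiskerLeft_comp, Category.assoc]
  rw [← e_assoc']
  simp

theorem map_precomp (F : EnrichedFunctor V C D) {a b : C} (r : 𝟙_ V ⟶ (a ⟶[V] b)) (c : C) :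
    F.map b c ≫ precomp V (r ≫ F.map a b) (F.obj c) = precomp V r c ≫ F.map a c := by
  dsimp only [precomp]
  rw [leftUnitor_inv_naturality_assoc, whisker_exchange_assoc, comp_whiskerRight_assoc,
    Category.assoc, Category.assoc, F.map_comp, MonoidalCategory.tensorHom_def_assoc]

theorem map_postcomp (F : EnrichedFunctor V C D) (a : C) {b c : C} (r : 𝟙_ V ⟶ (b ⟶[V] c)) :
    F.map a b ≫ postcomp V (F.obj a) (r ≫ F.map b c) = postcomp V a r ≫ F.map a c := by
  dsimp only [postcomp]
  rw [rightUnitor_inv_naturality_assoc, ← whisker_exchange_assoc,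
    MonoidalCategory.whiskerLeft_comp_assoc, Category.assoc, Category.assoc, F.map_comp,
    MonoidalCategory.tensorHom_def'_assoc]

theorem tensor_eComp_assoc {W X Y : V} {a b c d : C} (f : W ⟶ (a ⟶[V] b)) (g : X ⟶ (b ⟶[V] c))
    (h : Y ⟶ (c ⟶[V] d)) :
    (((f ⊗ₘ g) ≫ eComp V a b c) ⊗ₘ h) ≫ eComp V a c d =
      (α_ _ _ _).hom ≫ (f ⊗ₘ ((g ⊗ₘ h) ≫ eComp V b c d)) ≫ eComp V a b d := by
  have e₁ : (((f ⊗ₘ g) ≫ eComp V a b c) ⊗ₘ h) = ((f ⊗ₘ g) ⊗ₘ h) ≫ eComp V a b c ▷ _ := by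
    rw [← tensorHom_id, tensorHom_comp_tensorHom, Category.comp_id]
  have e₂ : (f ⊗ₘ ((g ⊗ₘ h) ≫ eComp V b c d)) = (f ⊗ₘ (g ⊗ₘ h)) ≫ _ ◁ eComp V b c d := by
    rw [← id_tensorHom, tensorHom_comp_tensorHom, Category.comp_id]
  rw [e₁, e₂, Category.assoc, Category.assoc, ← e_assoc', associator_naturality_assoc]

end Whisker

section Small

variable {V : Type v} [Category.{u} V] [MonoidalCategory V] [SymmetricCategory V]
variable {C : Type u₁} [EnrichedCategory V C] {D : Type u₂} [EnrichedCategory V D]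

instance isSmall_op [IsSmall V C] : IsSmall V Cᵒᵖ where
  small_isoClasses := by
    have := IsSmall.small_isoClasses (V := V) (C := C)
    refine small_of_injective
      (β := Quotient (isIsomorphicSetoid (ForgetEnrichment V C)))
      (f := Quotient.map (fun c => (forgetEnrichmentOppositeEquivalence V C).functor.obj c |>.unop)
        ?_) ?_
    · rintro a b ⟨e⟩
      exact ⟨((forgetEnrichmentOppositeEquivalence V C).functor.mapIso e.symm).unop⟩
    · rintro ⟨a⟩ ⟨b⟩ h
      obtain ⟨e⟩ := Quotient.exact h
      exact Quotient.sound
        ⟨(forgetEnrichmentOppositeEquivalence V C).functor.preimageIso e.symm.op⟩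

/-- Ordinary naturality of a `V`-natural family. -/
theorem IsNatFamily.conj {F G : EnrichedFunctor V C D} {X : V}
    {σ : ∀ c : C, X ⟶ (F.obj c ⟶[V] G.obj c)} (hσ : IsNatFamily V F G σ) {x y : C}
    (f : 𝟙_ V ⟶ (x ⟶[V] y)) :
    σ y ≫ precomp V (f ≫ F.map x y) (G.obj y) = σ x ≫ postcomp V (F.obj x) (f ≫ G.map x y) := by
  have h2 := (ρ_ X).inv ≫= (X ◁ f ≫= hσ x y)
  rw [braiding_naturality_right_assoc, braiding_tensorUnit_right] at h2
  dsimp only [precomp, postcomp]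
  rw [MonoidalCategory.tensorHom_def_assoc, MonoidalCategory.tensorHom_def_assoc] at h2
  simp only [Category.assoc, Iso.inv_hom_id_assoc] at h2
  rw [leftUnitor_inv_naturality_assoc, whisker_exchange_assoc, comp_whiskerRight_assoc, h2,
    whisker_exchange_assoc, rightUnitor_inv_naturality_assoc, MonoidalCategory.whiskerLeft_comp_assoc]

/-- A family which is natural on a set of representatives of the isomorphism classes extends to a
natural family. -/
theorem isNatFamily_extend {S : Type u₃} (i : S → C) (s : C → S)
    (r : ∀ c, 𝟙_ V ⟶ (c ⟶[V] i (s c))) (r' : ∀ c, 𝟙_ V ⟶ (i (s c) ⟶[V] c))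
    (h₁ : ∀ c d : C, precomp V (r' c) d ≫ precomp V (r c) d = 𝟙 _)
    (h₂ : ∀ c d : C, postcomp V d (r c) ≫ postcomp V d (r' c) = 𝟙 _)
    {F G : EnrichedFunctor V C D} {X : V} (σ : ∀ j : S, X ⟶ (F.obj (i j) ⟶[V] G.obj (i j)))
    (hσ : ∀ j k : S, (β_ X (i j ⟶[V] i k)).hom ≫ (F.map (i j) (i k) ⊗ₘ σ k) ≫
        eComp V (F.obj (i j)) (F.obj (i k)) (G.obj (i k)) =
      (σ j ⊗ₘ G.map (i j) (i k)) ≫ eComp V (F.obj (i j)) (G.obj (i j)) (G.obj (i k))) :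
    IsNatFamily V F G (fun c => σ (s c) ≫ precomp V (r c ≫ F.map c (i (s c))) (G.obj (i (s c))) ≫
      postcomp V (F.obj c) (r' c ≫ G.map (i (s c)) c)) := by
  intro x y
  have hF : (postcomp V x (r y) ≫ precomp V (r' x) (i (s y))) ≫ F.map (i (s x)) (i (s y)) ≫
      precomp V (r x ≫ F.map x (i (s x))) (F.obj (i (s y))) =
      F.map x y ≫ postcomp V (F.obj x) (r y ≫ F.map y (i (s y))) := by
    rw [map_precomp, Category.assoc, reassoc_of% (h₁ x (i (s y))), map_postcomp]
  have hG : (postcomp V x (r y) ≫ precomp V (r' x) (i (s y))) ≫ G.map (i (s x)) (i (s y)) ≫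
      postcomp V (G.obj (i (s x))) (r' y ≫ G.map (i (s y)) y) =
      G.map x y ≫ precomp V (r' x ≫ G.map (i (s x)) x) (G.obj y) := by
    rw [map_postcomp, map_precomp, Category.assoc, ← reassoc_of% postcomp_precomp (r' x) (r' y),
      reassoc_of% (h₂ y x)]
  have hn := hσ (s x) (s y)
  beta_reduce
  generalize r x ≫ F.map x (i (s x)) = fx at *
  generalize r y ≫ F.map y (i (s y)) = fy at *
  generalize r' x ≫ G.map (i (s x)) x = gx at *
  generalize r' y ≫ G.map (i (s y)) y = gy at *
  generalize postcomp V x (r y) ≫ precomp V (r' x) (i (s y)) = k at *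
  rw [MonoidalCategory.tensorHom_def_assoc, MonoidalCategory.tensorHom_def'_assoc] at hn
  have hL : (F.map x y ⊗ₘ (σ (s y) ≫ precomp V fy (G.obj (i (s y))) ≫
        postcomp V (F.obj y) gy)) ≫ eComp V (F.obj x) (F.obj y) (G.obj y) =
      k ▷ X ≫ (F.map (i (s x)) (i (s y)) ▷ X ≫ _ ◁ σ (s y) ≫ eComp V _ _ _) ≫
        precomp V fx _ ≫ postcomp V _ gy := by
    rw [MonoidalCategory.tensorHom_def, MonoidalCategory.whiskerLeft_comp,
      MonoidalCategory.whiskerLeft_comp]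
    simp only [Category.assoc]
    rw [← eComp_postcomp, ← reassoc_of% postcomp_eComp (F.obj x) (G.obj (i (s y))) fy,
      whisker_exchange_assoc, ← comp_whiskerRight_assoc, ← hF,
      reassoc_of% eComp_precomp fx (F.obj (i (s y))) (G.obj (i (s y)))]
    simp only [comp_whiskerRight, Category.assoc]
    rw [whisker_exchange_assoc]
  have hR : ((σ (s x) ≫ precomp V fx (G.obj (i (s x))) ≫ postcomp V (F.obj x) gx) ⊗ₘ
        G.map x y) ≫ eComp V (F.obj x) (G.obj x) (G.obj y) =
      X ◁ k ≫ (X ◁ G.map (i (s x)) (i (s y)) ≫ σ (s x) ▷ _ ≫ eComp V _ _ _) ≫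
        precomp V fx _ ≫ postcomp V _ gy := by
    rw [MonoidalCategory.tensorHom_def', comp_whiskerRight, comp_whiskerRight]
    simp only [Category.assoc]
    rw [postcomp_eComp, ← whisker_exchange_assoc, ← whisker_exchange_assoc,
      ← MonoidalCategory.whiskerLeft_comp_assoc, ← hG,
      reassoc_of% eComp_precomp fx (G.obj (i (s x))) (G.obj (i (s y))), eComp_postcomp]
    simp only [MonoidalCategory.whiskerLeft_comp, Category.assoc, whisker_exchange_assoc]
  rw [hL, hR, ← hn]
  simp only [Category.assoc]
  rw [braiding_naturality_right_assoc]

theorem IsNatObj.hom_ext {F G : EnrichedFunctor V C D} {E : V}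
    {π : ∀ c : C, E ⟶ (F.obj c ⟶[V] G.obj c)} (h : IsNatObj V F G E π) {X : V} {f g : X ⟶ E}
    (hfg : ∀ c, f ≫ π c = g ≫ π c) : f = g := by
  have hn : IsNatFamily V F G (fun c => f ≫ π c) := by
    intro x y
    have h1 := f ▷ (x ⟶[V] y) ≫= h.natural x y
    rw [braiding_naturality_left_assoc, MonoidalCategory.tensorHom_def_assoc,
      whisker_exchange_assoc] at h1
    simpa [MonoidalCategory.tensorHom_def] using h1
  exact (h.existsUnique X _ hn).unique (fun _ => rfl) (fun c => (hfg c).symm)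

theorem isNatFamily_id (F : EnrichedFunctor V C D) :
    IsNatFamily V F F (fun c => eId V (F.obj c)) := by
  intro x y
  rw [braiding_tensorUnit_left, MonoidalCategory.tensorHom_def_assoc,
    MonoidalCategory.tensorHom_def'_assoc, Category.assoc, ← rightUnitor_inv_naturality_assoc,
    e_comp_id, ← cancel_epi (λ_ (x ⟶[V] y)).inv, Iso.inv_hom_id_assoc,
    ← leftUnitor_inv_naturality_assoc, e_id_comp]

theorem isNatFamily_comp {F G H : EnrichedFunctor V C D} {X Y : V}
    {σ : ∀ c : C, X ⟶ (F.obj c ⟶[V] G.obj c)} (hσ : IsNatFamily V F G σ)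
    {τ : ∀ c : C, Y ⟶ (G.obj c ⟶[V] H.obj c)} (hτ : IsNatFamily V G H τ) :
    IsNatFamily V F H (fun c => (σ c ⊗ₘ τ c) ≫ eComp V (F.obj c) (G.obj c) (H.obj c)) := by
  intro x y
  have e₁ : (((σ x ⊗ₘ τ x) ≫ eComp V _ _ _) ⊗ₘ H.map x y) ≫
      eComp V (F.obj x) (H.obj x) (H.obj y) =
      (α_ _ _ _).hom ≫ (σ x ⊗ₘ ((τ x ⊗ₘ H.map x y) ≫ eComp V _ _ _)) ≫ eComp V _ _ _ :=
    tensor_eComp_assoc _ _ _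
  have e₂ : (σ x ⊗ₘ ((G.map x y ⊗ₘ τ y) ≫ eComp V _ _ _)) ≫
      eComp V (F.obj x) (G.obj x) (H.obj y) =
      (α_ _ _ _).inv ≫ (((σ x ⊗ₘ G.map x y) ≫ eComp V _ _ _) ⊗ₘ τ y) ≫ eComp V _ _ _ := by
    rw [tensor_eComp_assoc, Iso.inv_hom_id_assoc]
  have e₃ : (F.map x y ⊗ₘ ((σ y ⊗ₘ τ y) ≫ eComp V _ _ _)) ≫
      eComp V (F.obj x) (F.obj y) (H.obj y) =
      (α_ _ _ _).inv ≫ (((F.map x y ⊗ₘ σ y) ≫ eComp V _ _ _) ⊗ₘ τ y) ≫ eComp V _ _ _ := by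
    rw [tensor_eComp_assoc, Iso.inv_hom_id_assoc]
  rw [e₁, ← hτ x y]
  have e₄ : (σ x ⊗ₘ ((β_ Y (x ⟶[V] y)).hom ≫ (G.map x y ⊗ₘ τ y) ≫ eComp V _ _ _)) ≫
      eComp V (F.obj x) (G.obj x) (H.obj y) =
      X ◁ (β_ Y (x ⟶[V] y)).hom ≫ (σ x ⊗ₘ ((G.map x y ⊗ₘ τ y) ≫ eComp V _ _ _)) ≫
      eComp V (F.obj x) (G.obj x) (H.obj y) := by
    simp only [MonoidalCategory.tensorHom_def', MonoidalCategory.whiskerLeft_comp, Category.assoc]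
  have e₅ : (((β_ X (x ⟶[V] y)).hom ≫ (F.map x y ⊗ₘ σ y) ≫ eComp V _ _ _) ⊗ₘ τ y) ≫
      eComp V (F.obj x) (G.obj y) (H.obj y) =
      (β_ X (x ⟶[V] y)).hom ▷ Y ≫ (((F.map x y ⊗ₘ σ y) ≫ eComp V _ _ _) ⊗ₘ τ y) ≫
      eComp V (F.obj x) (G.obj y) (H.obj y) := by
    simp only [MonoidalCategory.tensorHom_def, comp_whiskerRight, Category.assoc]
  rw [e₄, e₂, ← hσ x y, e₅, e₃, braiding_tensor_left_hom]
  simp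

section Existence

variable [MonoidalClosed V] [HasLimits V]

/-- The object of `V`-natural transformations exists when the domain is small. -/
theorem exists_isNatObj [IsSmall V C] (F G : EnrichedFunctor V C D) :
    ∃ (E : V) (π : ∀ c : C, E ⟶ (F.obj c ⟶[V] G.obj c)), IsNatObj V F G E π := by
  have hsm : Small.{u} (Quotient (isIsomorphicSetoid (ForgetEnrichment V C))) :=
    IsSmall.small_isoClasses
  let S := Shrink.{u} (Quotient (isIsomorphicSetoid (ForgetEnrichment V C)))
  let i : S → C := fun j => ((equivShrink _).symm j).out
  let s : C → S := fun c => equivShrink _ (Quotient.mk _ (ForgetEnrichment.of V c))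
  have he : ∀ c, Nonempty (ForgetEnrichment.of V c ≅ ForgetEnrichment.of V (i (s c))) := by
    intro c
    apply Quotient.exact (s := isIsomorphicSetoid (ForgetEnrichment V C))
    simp only [i, s, Equiv.symm_apply_apply]
    exact (Quotient.out_eq _).symm
  let e := fun c => (he c).some
  let r : ∀ c, 𝟙_ V ⟶ (c ⟶[V] i (s c)) := fun c => ForgetEnrichment.homTo V (e c).hom
  let r' : ∀ c, 𝟙_ V ⟶ (i (s c) ⟶[V] c) := fun c => ForgetEnrichment.homTo V (e c).inv
  have h₁ : ∀ c d : C, precomp V (r' c) d ≫ precomp V (r c) d = 𝟙 _ :=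
    fun c d => precomp_inv_hom (e c) d
  have h₂ : ∀ c d : C, postcomp V d (r c) ≫ postcomp V d (r' c) = 𝟙 _ :=
    fun c d => postcomp_hom_inv (e c) d
  let P : V := ∏ᶜ fun j : S => (F.obj (i j) ⟶[V] G.obj (i j))
  let Q : V := ∏ᶜ fun p : S × S =>
    (ihom (i p.1 ⟶[V] i p.2)).obj (F.obj (i p.1) ⟶[V] G.obj (i p.2))
  let l : P ⟶ Q := Pi.lift fun p => MonoidalClosed.curry
    ((F.map (i p.1) (i p.2) ⊗ₘ Pi.π _ p.2) ≫ eComp V _ _ _)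
  let m : P ⟶ Q := Pi.lift fun p => MonoidalClosed.curry
    ((β_ _ _).hom ≫ (Pi.π _ p.1 ⊗ₘ G.map (i p.1) (i p.2)) ≫ eComp V _ _ _)
  have key : ∀ (X : V) (t : X ⟶ P), t ≫ l = t ≫ m ↔ ∀ j k : S,
      (β_ X (i j ⟶[V] i k)).hom ≫ (F.map (i j) (i k) ⊗ₘ (t ≫ Pi.π _ k)) ≫
        eComp V (F.obj (i j)) (F.obj (i k)) (G.obj (i k)) =
      ((t ≫ Pi.π _ j) ⊗ₘ G.map (i j) (i k)) ≫
        eComp V (F.obj (i j)) (G.obj (i j)) (G.obj (i k)) := by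
    intro X t
    have hjk : ∀ j k : S, (t ≫ l) ≫ Pi.π _ (j, k) = (t ≫ m) ≫ Pi.π _ (j, k) ↔
        (β_ X (i j ⟶[V] i k)).hom ≫ (F.map (i j) (i k) ⊗ₘ (t ≫ Pi.π _ k)) ≫
          eComp V (F.obj (i j)) (F.obj (i k)) (G.obj (i k)) =
        ((t ≫ Pi.π _ j) ⊗ₘ G.map (i j) (i k)) ≫
          eComp V (F.obj (i j)) (G.obj (i j)) (G.obj (i k)) := by
      intro j k
      simp only [l, m, Category.assoc, Pi.lift_π, ← MonoidalClosed.curry_natural_left]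
      rw [MonoidalClosed.curry_injective.eq_iff, braiding_naturality_right_assoc,
        ← Iso.inv_comp_eq, ← SymmetricCategory.braiding_swap_eq_inv_braiding]
      have e₁ : ((i j ⟶[V] i k) ◁ t ≫ (F.map (i j) (i k) ⊗ₘ Pi.π _ k) ≫
          eComp V (F.obj (i j)) (F.obj (i k)) (G.obj (i k))) =
          (F.map (i j) (i k) ⊗ₘ (t ≫ Pi.π (fun j : S => (F.obj (i j) ⟶[V] G.obj (i j))) k)) ≫
          eComp V (F.obj (i j)) (F.obj (i k)) (G.obj (i k)) := by
        rw [MonoidalCategory.tensorHom_def_assoc, whisker_exchange_assoc]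
        simp [MonoidalCategory.tensorHom_def]
      have e₂ : (t ▷ (i j ⟶[V] i k) ≫ (Pi.π _ j ⊗ₘ G.map (i j) (i k)) ≫
          eComp V (F.obj (i j)) (G.obj (i j)) (G.obj (i k))) =
          ((t ≫ Pi.π (fun j : S => (F.obj (i j) ⟶[V] G.obj (i j))) j) ⊗ₘ G.map (i j) (i k)) ≫
          eComp V (F.obj (i j)) (G.obj (i j)) (G.obj (i k)) := by
        simp [MonoidalCategory.tensorHom_def]
      rw [← e₁, ← e₂]
    constructor
    · intro h j k
      rw [← hjk, h]
    · intro h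
      apply Pi.hom_ext
      rintro ⟨j, k⟩
      exact (hjk j k).2 (h j k)
  have ext : ∀ {X : V} {σ : ∀ c : C, X ⟶ (F.obj c ⟶[V] G.obj c)}, IsNatFamily V F G σ → ∀ c,
      σ (i (s c)) ≫ precomp V (r c ≫ F.map c (i (s c))) (G.obj (i (s c))) ≫
        postcomp V (F.obj c) (r' c ≫ G.map (i (s c)) c) = σ c := by
    intro X σ hσ c
    have h := postcomp_hom_inv (G.forget.mapIso (e c)) (F.obj c)
    rw [reassoc_of% hσ.conj (r c)]
    exact (σ c ≫= h).trans (Category.comp_id _)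
  have hnat := isNatFamily_extend i s r r' h₁ h₂ (F := F) (G := G)
    (fun j => equalizer.ι l m ≫ Pi.π _ j) ((key _ _).1 (equalizer.condition l m))
  refine ⟨equalizer l m, _, hnat, fun X σ hσ => ?_⟩
  have hc : Pi.lift (fun j => σ (i j)) ≫ l = Pi.lift (fun j => σ (i j)) ≫ m := by
    rw [key]
    intro j k
    simpa using hσ (i j) (i k)
  refine ⟨equalizer.lift _ hc, fun c => ?_, fun f hf => ?_⟩
  · simp [ext hσ]
  · apply equalizer.hom_ext
    apply Pi.hom_ext
    intro j
    obtain ⟨c, rfl⟩ : ∃ c, s c = j := by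
      refine ⟨i j, ?_⟩
      simp only [s, i]
      rw [← Equiv.eq_symm_apply]
      exact Quotient.out_eq _
    have hp : precomp V (r c ≫ F.map c (i (s c))) (G.obj (i (s c))) ≫
        precomp V (r' c ≫ F.map (i (s c)) c) (G.obj (i (s c))) = 𝟙 _ :=
      precomp_inv_hom (F.forget.mapIso (e c)).symm (G.obj (i (s c)))
    have hq : postcomp V (F.obj c) (r' c ≫ G.map (i (s c)) c) ≫
        postcomp V (F.obj c) (r c ≫ G.map c (i (s c))) = 𝟙 _ :=
      postcomp_hom_inv (G.forget.mapIso (e c)).symm (F.obj c)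
    have h := (hf c).trans (ext hσ c).symm
    have h' := (h =≫ postcomp V (F.obj c) (r c ≫ G.map c (i (s c)))) =≫
      precomp V (r' c ≫ F.map (i (s c)) c) (G.obj (i (s c)))
    simp only [Category.assoc, reassoc_of% hq, hp, Category.comp_id] at h'
    simpa using h'

/-- The `V`-object `[C, D](F, G) = ∫ c, D(F c, G c)` of `V`-natural transformations. -/
def natObj [IsSmall V C] (F G : EnrichedFunctor V C D) : V := (exists_isNatObj F G).choose

/-- The projections `∫ c, D(F c, G c) ⟶ D(F c, G c)`. -/
def natProj [IsSmall V C] (F G : EnrichedFunctor V C D) (c : C) :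
    natObj F G ⟶ (F.obj c ⟶[V] G.obj c) := (exists_isNatObj F G).choose_spec.choose c

theorem isNatObj_natObj [IsSmall V C] (F G : EnrichedFunctor V C D) :
    IsNatObj V F G (natObj F G) (natProj F G) := (exists_isNatObj F G).choose_spec.choose_spec

/-- The arrow into `[C, D](F, G)` induced by a `V`-natural family. -/
def natLift [IsSmall V C] {F G : EnrichedFunctor V C D} {X : V}
    (σ : ∀ c : C, X ⟶ (F.obj c ⟶[V] G.obj c)) (hσ : IsNatFamily V F G σ) : X ⟶ natObj F G :=
  ((isNatObj_natObj F G).existsUnique X σ hσ).choose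

theorem natLift_natProj [IsSmall V C] {F G : EnrichedFunctor V C D} {X : V}
    (σ : ∀ c : C, X ⟶ (F.obj c ⟶[V] G.obj c)) (hσ : IsNatFamily V F G σ) (c : C) :
    natLift σ hσ ≫ natProj F G c = σ c :=
  ((isNatObj_natObj F G).existsUnique X σ hσ).choose_spec.1 c

/-- The `V`-category `[C, D]` of `V`-functors from a small `V`-category `C`. -/
instance functorCategory [IsSmall V C] : EnrichedCategory V (EnrichedFunctor V C D) where
  Hom F G := natObj F G
  id F := natLift _ (isNatFamily_id F)
  comp F G H := natLift _ (isNatFamily_comp (isNatObj_natObj F G).natural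
    (isNatObj_natObj G H).natural)
  id_comp F G := by
    apply (isNatObj_natObj F G).hom_ext
    intro c
    simp only [Category.assoc, natLift_natProj, Category.id_comp]
    rw [MonoidalCategory.tensorHom_def_assoc, ← comp_whiskerRight_assoc, natLift_natProj,
      ← whisker_exchange_assoc, ← leftUnitor_inv_naturality_assoc, e_id_comp, Category.comp_id]
  comp_id F G := by
    apply (isNatObj_natObj F G).hom_ext
    intro c
    simp only [Category.assoc, natLift_natProj, Category.id_comp]
    rw [MonoidalCategory.tensorHom_def'_assoc, ← MonoidalCategory.whiskerLeft_comp_assoc,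
      natLift_natProj, whisker_exchange_assoc, ← rightUnitor_inv_naturality_assoc, e_comp_id,
      Category.comp_id]
  assoc F G H K := by
    apply (isNatObj_natObj F K).hom_ext
    intro c
    simp only [Category.assoc, natLift_natProj]
    have e₁ : ∀ {X Y : V} {P Q R : EnrichedFunctor V C D} (f : X ⟶ natObj P Q) (g : Y ⟶ natObj Q R),
        (f ⊗ₘ g) ≫ (natProj P Q c ⊗ₘ natProj Q R c) = (f ≫ natProj P Q c) ⊗ₘ (g ≫ natProj Q R c) :=
      fun f g => by simp
    rw [← tensorHom_id, ← id_tensorHom, reassoc_of% e₁, reassoc_of% e₁, natLift_natProj,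
      natLift_natProj, Category.id_comp, Category.id_comp, tensor_eComp_assoc,
      Iso.inv_hom_id_assoc]

/-- Evaluation at `c`, as a `V`-functor `[C, D] ⟶ D`. -/
def evalFunctor [IsSmall V C] (c : C) : EnrichedFunctor V (EnrichedFunctor V C D) D where
  obj F := F.obj c
  map F G := natProj F G c
  map_id F := natLift_natProj _ (isNatFamily_id F) c
  map_comp F G H := natLift_natProj _ (isNatFamily_comp (isNatObj_natObj F G).natural
    (isNatObj_natObj G H).natural) c

end Existence

/-- The covariant hom `V`-functor `A(a, -) : A ⟶ V`. -/
def homFunctor [MonoidalClosed V] (a : C) : EnrichedFunctor V C V where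
  obj b := a ⟶[V] b
  map b c := MonoidalClosed.curry (eComp V a b c)
  map_id b := by
    rw [← MonoidalClosed.curry_natural_left]
    have h := e_comp_id V a b
    rw [Iso.inv_comp_eq, Category.comp_id] at h
    rw [h]
    rfl
  map_comp b c d := by
    change _ = (_ ⊗ₘ _) ≫ MonoidalClosed.curry ((α_ _ _ _).inv ≫
      (ihom.ev (a ⟶[V] b)).app (a ⟶[V] c) ▷ _ ≫ (ihom.ev (a ⟶[V] c)).app (a ⟶[V] d))
    rw [← MonoidalClosed.curry_natural_left, ← MonoidalClosed.curry_natural_left]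
    congr 1
    rw [← e_assoc, MonoidalCategory.tensorHom_def, MonoidalCategory.whiskerLeft_comp_assoc,
      associator_inv_naturality_right_assoc, associator_inv_naturality_middle_assoc,
      whisker_exchange_assoc, ← comp_whiskerRight_assoc]
    erw [MonoidalClosed.whiskerLeft_curry_ihom_ev_app, MonoidalClosed.whiskerLeft_curry_ihom_ev_app]

end Small

section Weighted

variable {V : Type v} [Category.{u} V] [MonoidalCategory V] [SymmetricCategory V]
  [MonoidalClosed V]

/-- Given `μ : φ ⟶ A(l, T -)`, the component at `j` of the transformation
`A(a, l) ⟶ [J, V](φ, A(a, T -))` which is induced by `μ` and the composition of `A`. -/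
def limitTransform {J : Type u₁} [EnrichedCategory V J] {A : Type u₂} [EnrichedCategory V A]
    (φ : EnrichedFunctor V J V) (T : EnrichedFunctor V J A) {l : A}
    (μ : ∀ j : J, φ.obj j ⟶ (l ⟶[V] T.obj j)) (a : A) (j : J) :
    (a ⟶[V] l) ⟶ (EnrichedCategory.Hom (φ.obj j) (a ⟶[V] T.obj j) : V) :=
  MonoidalClosed.curry ((β_ _ _).hom ≫ _ ◁ μ j ≫ eComp V a l (T.obj j))

/-- `l`, with the counit `μ : φ ⟶ A(l, T -)`, is the weighted limit `{φ, T}`: the arrow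
`A(a, l) ⟶ [J, V](φ, A(a, T -))` induced by `μ` is invertible for all `a`, which is to say that
`A(a, l)` is the object of `V`-natural transformations from `φ` to `A(a, T -)`. (The
`V`-naturality of `μ` is the case `a = l`.) -/
def IsWeightedLimit {J : Type u₁} [EnrichedCategory V J] {A : Type u₂} [EnrichedCategory V A]
    (φ : EnrichedFunctor V J V) (T : EnrichedFunctor V J A) (l : A)
    (μ : ∀ j : J, φ.obj j ⟶ (l ⟶[V] T.obj j)) : Prop :=
  ∀ a : A, IsNatObj V φ (T.comp V (homFunctor a)) (a ⟶[V] l) (limitTransform φ T μ a)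

/-- `c`, with the unit `η : φ ⟶ A(S -, c)`, is the weighted colimit `φ * S`, i.e. the limit
`{φ, Sᵒᵖ}` in `Aᵒᵖ`. -/
def IsWeightedColimit {K : Type u₁} [EnrichedCategory V K] {A : Type u₂} [EnrichedCategory V A]
    (φ : EnrichedFunctor V Kᵒᵖ V) (S : EnrichedFunctor V K A) (c : A)
    (η : ∀ k : Kᵒᵖ, φ.obj k ⟶ (S.obj k.unop ⟶[V] c)) : Prop :=
  IsWeightedLimit φ (opFunctor V S) (op c) η

variable (V) in
/-- A class of weights: for each small `K`, a class of `V`-functors `Kᵒᵖ ⟶ V`. -/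
def WeightClass : Type (max u v (w + 1)) :=
  ∀ (K : Type w) [EnrichedCategory V K] [IsSmall V K], EnrichedFunctor V Kᵒᵖ V → Prop

variable (V) in
/-- The class of all weights. -/
def allWeights : WeightClass.{u, v, w} V := fun _ _ _ _ => True

/-- `A` admits `Φ`-colimits. -/
def IsCocomplete (Φ : WeightClass.{u, v, w} V) (A : Type u₂) [EnrichedCategory V A] : Prop :=
  ∀ (K : Type w) [EnrichedCategory V K] [IsSmall V K] (φ : EnrichedFunctor V Kᵒᵖ V), Φ K φ →
    ∀ S : EnrichedFunctor V K A,
      ∃ (c : A) (η : ∀ k : Kᵒᵖ, φ.obj k ⟶ (S.obj k.unop ⟶[V] c)), IsWeightedColimit φ S c η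

/-- `F` preserves `Φ`-limits. -/
def IsContinuous (Φ : WeightClass.{u, v, w} V) {A : Type u₂} [EnrichedCategory V A]
    {B : Type u₃} [EnrichedCategory V B] (F : EnrichedFunctor V A B) : Prop :=
  ∀ (K : Type w) [EnrichedCategory V K] [IsSmall V K] (φ : EnrichedFunctor V Kᵒᵖ V), Φ K φ →
    ∀ (T : EnrichedFunctor V Kᵒᵖ A) (l : A) (μ : ∀ k : Kᵒᵖ, φ.obj k ⟶ (l ⟶[V] T.obj k)),
      IsWeightedLimit φ T l μ →
        IsWeightedLimit φ (T.comp V F) (F.obj l) (fun k => μ k ≫ F.map l (T.obj k))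

/-- The full subcategory of `A` on the objects satisfying `P` is closed under `Φ`-limits. -/
def ClosedUnderLimits (Φ : WeightClass.{u, v, w} V) {A : Type u₂} [EnrichedCategory V A]
    (P : A → Prop) : Prop :=
  ∀ (K : Type w) [EnrichedCategory V K] [IsSmall V K] (φ : EnrichedFunctor V Kᵒᵖ V), Φ K φ →
    ∀ (T : EnrichedFunctor V Kᵒᵖ A) (l : A) (μ : ∀ k : Kᵒᵖ, φ.obj k ⟶ (l ⟶[V] T.obj k)),
      (∀ k, P (T.obj k)) → IsWeightedLimit φ T l μ → P l

/-- The full subcategory of `A` on the objects satisfying `P` is closed under `Φ`-colimits. -/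
def ClosedUnderColimits (Φ : WeightClass.{u, v, w} V) {A : Type u₂} [EnrichedCategory V A]
    (P : A → Prop) : Prop :=
  ∀ (K : Type w) [EnrichedCategory V K] [IsSmall V K] (φ : EnrichedFunctor V Kᵒᵖ V), Φ K φ →
    ∀ (S : EnrichedFunctor V K A) (c : A) (η : ∀ k : Kᵒᵖ, φ.obj k ⟶ (S.obj k.unop ⟶[V] c)),
      (∀ k, P (S.obj k)) → IsWeightedColimit φ S c η → P c

/-- The closure `Φ{P}` of a full subcategory of `A` under `Φ`-colimits: the smallest full replete
subcategory containing it and closed under `Φ`-colimits. -/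
def colimitClosure (Φ : WeightClass.{u, v, w} V) {A : Type u₂} [EnrichedCategory V A]
    (P : A → Prop) (a : A) : Prop :=
  ∀ Q : A → Prop, (∀ x y, ObjIso V x y → Q x → Q y) → (∀ x, P x → Q x) →
    ClosedUnderColimits Φ Q → Q a

/-- `d`, with the unit `r : x ⟶ d`, is a reflexion of `x` into the full subcategory of `A` on the
objects satisfying `P`. -/
structure IsReflection {A : Type u₂} [EnrichedCategory V A] (P : A → Prop) (x d : A)
    (r : 𝟙_ V ⟶ (x ⟶[V] d)) : Prop where
  mem : P d
  isIso : ∀ c, P c → IsIso (precomp V r c)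

/-- The representable presheaf `C(-, c)`, the value at `c` of the Yoneda embedding. -/
def representable {C : Type u₁} [EnrichedCategory V C] (c : C) : EnrichedFunctor V Cᵒᵖ V :=
  homFunctor (op c)

section Presheaves

variable [HasLimits V]

/-- `W`, with the units `η F : φ ⟶ [F -, W F]`, is the functor `φ * - : [L, V] ⟶ V`: each `W F` is
the colimit `φ * F`, and the units are `V`-natural in `F`. -/
structure IsColimitFunctor {L : Type w} [EnrichedCategory V L] [IsSmall V L]
    (φ : EnrichedFunctor V Lᵒᵖ V) (W : EnrichedFunctor V (EnrichedFunctor V L V) V)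
    (η : ∀ (F : EnrichedFunctor V L V) (k : Lᵒᵖ), φ.obj k ⟶ (EnrichedCategory.Hom (F.obj k.unop) (W.obj F) : V)) :
    Prop where
  isColimit : ∀ F, IsWeightedColimit φ F (W.obj F) (η F)
  natural : ∀ k : Lᵒᵖ, IsNatFamily V (evalFunctor k.unop) W (fun F => η F k)

/-- The class `Φ⁺` of `Φ`-flat weights: those `φ : Lᵒᵖ ⟶ V` for which the functor
`φ * - : [L, V] ⟶ V` preserves `Φ`-limits. (This functor is determined up to isomorphism, and it
exists when `V` is cocomplete.) -/
def flatWeights (Φ : WeightClass.{u, v, w} V) : WeightClass.{u, v, w} V := fun L _ _ φ =>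
  ∃ (W : EnrichedFunctor V (EnrichedFunctor V L V) V)
    (η : ∀ (F : EnrichedFunctor V L V) (k : Lᵒᵖ), φ.obj k ⟶ (EnrichedCategory.Hom (F.obj k.unop) (W.obj F) : V)),
    IsColimitFunctor φ W η ∧ IsContinuous Φ W

/-- `Φ(N)`, the closure of the representables in `[Nᵒᵖ, V]` under `Φ`-colimits. -/
def freeCocompletion (Φ : WeightClass.{u, v, w} V) (N : Type u₁) [EnrichedCategory V N]
    [IsSmall V N] : EnrichedFunctor V Nᵒᵖ V → Prop :=
  colimitClosure Φ fun F => ∃ n : N, F = representable n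

end Presheaves

end Weighted

end EnrichedFlat

end

open EnrichedFlat

/-! A presheaf `H` is `Φ`-continuous when it turns each `Φ`-colimit of `N` into a limit, and
everything follows from interchanging limits and from the universal property of colimits.

Limits commute with limits (`PreservesCylinder.of_pointwise`), so a limit of continuous functors is
continuous. Limits in a functor category over a small base are pointwise, because evaluation at `a`
is isomorphic to the hom-functor out of `A(a, -)`. For a `Φ`-flat weight `φ` on `L` and a diagram
`S` of continuous functors, the pointwise colimit is the composite of the transpose `A ⟶ [L, V]` of
`S` with `φ * -`. The transpose preserves `Φ`-limits because each `S k` does, and `φ * -` preserves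
them by flatness. Hence the colimit is continuous, and with the continuity of representables this
gives (a).

For reflections, let `c` be a colimit of `S` and let each `S k` have a reflection `d k`. The
universal property makes `d` a functor. If a continuous object sees some `e` as the colimit of the
`d k`, then the comparison from `c` to `e` is orthogonal to that object
(`IsWeightedColimit.exists_isIso_precomp`). So if `e` is itself continuous, and every continuous
object sees it in this way, then it is the reflection of `c`. For (c), the `d k` are representable
and the weight lies in `Φ`. The functor `d` lands in `N`, which has the colimit `m`, and a
continuous `H` sees `N(-, m)` as the colimit of the `N(-, d k)`, since `[N(-, n), H]` is `H n` by
Yoneda. For (b), the weight is flat, and the colimit of the reflections is already continuous by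
(a). Both statements pass to the closures by induction, that is, by minimality of the closure.

The calculations replace a `V`-functor `F : A ⟶ V` by its action `F a ⊗ A(a, b) ⟶ F b`. One notion,
`PreservesCylinder`, then expresses both that a cylinder is a limit (for the actions of all `A(a,
-)`) and that `F` preserves it. -/

noncomputable section

namespace EnrichedFlat

/-! ### Actions of a `V`-category, linear families and cylinders -/

section Action

variable {V : Type v} [Category.{u} V] [MonoidalCategory V] [MonoidalClosed V]
variable {J : Type u₁} [EnrichedCategory V J] {A : Type u₂} [EnrichedCategory V A]
  {B : Type u₃} [EnrichedCategory V B]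

/-- The right action `F a ⊗ A(a, b) ⟶ F b` of a `V`-category `A` on a `V`-functor `A ⟶ V`. -/
def act (F : EnrichedFunctor V A V) (a b : A) : F.obj a ⊗ (a ⟶[V] b) ⟶ F.obj b :=
  MonoidalClosed.uncurry (F.map a b)

/-- Composition in `V` is the curried form of a double evaluation. Undoing the currying allows later
identities to be checked on tensor products. -/
theorem uncurry_tensor_eComp {a b c X Y : V} (f : X ⟶ (ihom a).obj b) (g : Y ⟶ (ihom b).obj c) :
    MonoidalClosed.uncurry ((f ⊗ₘ g) ≫ eComp V a b c) =
      (α_ a X Y).inv ≫ MonoidalClosed.uncurry f ▷ Y ≫ MonoidalClosed.uncurry g := by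
  rw [MonoidalClosed.enrichedCategorySelf_comp]
  have : MonoidalClosed.comp a b c =
      MonoidalClosed.curry ((α_ _ _ _).inv ≫ (ihom.ev a).app b ▷ _ ≫ (ihom.ev b).app c) := rfl
  rw [MonoidalClosed.uncurry_natural_left, this, MonoidalClosed.uncurry_curry,
    MonoidalCategory.tensorHom_def, MonoidalCategory.whiskerLeft_comp_assoc,
    associator_inv_naturality_right_assoc, associator_inv_naturality_middle_assoc,
    whisker_exchange_assoc, ← comp_whiskerRight_assoc, MonoidalClosed.uncurry_eq,
    MonoidalClosed.uncurry_eq]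
  rfl

theorem uncurry_eId (a : V) : MonoidalClosed.uncurry (eId V a) = (ρ_ a).hom := by
  rw [MonoidalClosed.enrichedCategorySelf_id]
  exact MonoidalClosed.uncurry_curry _

/-- The family `f` is a right action of the `V`-category `A` on the family `F`. -/
structure IsAction {F : A → V} (f : ∀ a b, F a ⊗ (a ⟶[V] b) ⟶ F b) : Prop where
  whiskerLeft_eComp : ∀ a b c, F a ◁ eComp V a b c ≫ f a c = (α_ _ _ _).inv ≫ f a b ▷ _ ≫ f b c
  whiskerLeft_eId : ∀ a, F a ◁ eId V a ≫ f a a = (ρ_ _).hom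

theorem isAction_act (F : EnrichedFunctor V A V) : IsAction (act F) where
  whiskerLeft_eComp a b c := by
    have h := congrArg MonoidalClosed.uncurry (F.map_comp a b c)
    rw [uncurry_tensor_eComp, MonoidalClosed.uncurry_natural_left] at h
    exact h
  whiskerLeft_eId a := by
    have h := congrArg MonoidalClosed.uncurry (F.map_id a)
    rw [uncurry_eId, MonoidalClosed.uncurry_natural_left] at h
    exact h

omit [MonoidalClosed V] in
theorem isAction_eComp (a : A) : IsAction (eComp V a) where
  whiskerLeft_eComp b c d := (e_assoc V a b c d).symm
  whiskerLeft_eId b := by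
    rw [← cancel_epi (ρ_ _).inv, e_comp_id, Iso.inv_hom_id]

/-- A family of arrows `X ⊗ P j ⟶ Q j` which commutes with the actions `p` and `q` of `J`. -/
def IsLinear {P Q : J → V} (p : ∀ i j, P i ⊗ (i ⟶[V] j) ⟶ P j)
    (q : ∀ i j, Q i ⊗ (i ⟶[V] j) ⟶ Q j) {X : V} (τ : ∀ j, X ⊗ P j ⟶ Q j) : Prop :=
  ∀ i j, X ◁ p i j ≫ τ j = (α_ _ _ _).inv ≫ τ i ▷ _ ≫ q i j

/-- The family `m` is universal amongst the linear families `X ⊗ P j ⟶ Q j`. -/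
structure IsUniversal {P Q : J → V} (p : ∀ i j, P i ⊗ (i ⟶[V] j) ⟶ P j)
    (q : ∀ i j, Q i ⊗ (i ⟶[V] j) ⟶ Q j) (E : V) (m : ∀ j, E ⊗ P j ⟶ Q j) : Prop where
  linear : IsLinear p q m
  existsUnique : ∀ (X : V) (τ : ∀ j, X ⊗ P j ⟶ Q j), IsLinear p q τ →
    ∃! f : X ⟶ E, ∀ j, f ▷ P j ≫ m j = τ j

/-- A family of arrows `Q j ⟶ Q' j` which commutes with the actions `q` and `q'` of `J`. -/
def IsModuleHom {Q Q' : J → V} (q : ∀ i j, Q i ⊗ (i ⟶[V] j) ⟶ Q j)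
    (q' : ∀ i j, Q' i ⊗ (i ⟶[V] j) ⟶ Q' j) (θ : ∀ j, Q j ⟶ Q' j) : Prop :=
  ∀ i j, q i j ≫ θ j = θ i ▷ _ ≫ q' i j

section Modules

variable {P Q Q' : J → V} {p : ∀ i j, P i ⊗ (i ⟶[V] j) ⟶ P j}
  {q : ∀ i j, Q i ⊗ (i ⟶[V] j) ⟶ Q j} {q' : ∀ i j, Q' i ⊗ (i ⟶[V] j) ⟶ Q' j}

omit [MonoidalClosed V]

theorem IsLinear.whiskerRight {X Y : V} {τ : ∀ j, X ⊗ P j ⟶ Q j} (h : IsLinear p q τ)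
    (f : Y ⟶ X) : IsLinear p q fun j => f ▷ P j ≫ τ j := by
  intro i j
  rw [whisker_exchange_assoc, h i j]
  simp

theorem IsUniversal.hom_ext {E : V} {m : ∀ j, E ⊗ P j ⟶ Q j} (h : IsUniversal p q E m) {X : V}
    {f g : X ⟶ E} (hfg : ∀ j, f ▷ P j ≫ m j = g ▷ P j ≫ m j) : f = g :=
  (h.existsUnique X _ (h.linear.whiskerRight f)).unique (fun _ => rfl) fun j => (hfg j).symm

theorem isUniversal_congr {r : ∀ i j, Q i ⊗ (i ⟶[V] j) ⟶ Q j} {E : V}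
    {m n : ∀ j, E ⊗ P j ⟶ Q j} (hq : ∀ i j, q i j = r i j) (hm : ∀ j, m j = n j) :
    IsUniversal p q E m ↔ IsUniversal p r E n := by
  obtain rfl : q = r := funext fun i => funext fun j => hq i j
  obtain rfl : m = n := funext hm
  rfl

theorem IsModuleHom.inv {θ : ∀ j, Q j ⟶ Q' j} (h : IsModuleHom q q' θ) [∀ j, IsIso (θ j)] :
    IsModuleHom q' q fun j => inv (θ j) := by
  intro i j
  rw [← cancel_mono (θ j), ← cancel_epi (θ i ▷ _)]
  simp only [Category.assoc, IsIso.inv_hom_id, Category.comp_id]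
  rw [h i j, ← comp_whiskerRight_assoc]
  simp

theorem IsLinear.comp {X : V} {τ : ∀ j, X ⊗ P j ⟶ Q j} (h : IsLinear p q τ)
    {θ : ∀ j, Q j ⟶ Q' j} (hθ : IsModuleHom q q' θ) : IsLinear p q' fun j => τ j ≫ θ j := by
  intro i j
  rw [← Category.assoc, h i j]
  simp [hθ i j]

/-- Universal families are unique up to isomorphism. -/
theorem IsUniversal.isIso {E E' : V} {m : ∀ j, E ⊗ P j ⟶ Q j} {m' : ∀ j, E' ⊗ P j ⟶ Q' j}
    (h : IsUniversal p q E m) (h' : IsUniversal p q' E' m') {θ : ∀ j, Q j ⟶ Q' j}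
    (hθ : IsModuleHom q q' θ) [∀ j, IsIso (θ j)] (f : E ⟶ E')
    (hf : ∀ j, f ▷ P j ≫ m' j = m j ≫ θ j) : IsIso f := by
  obtain ⟨g, hg, -⟩ := h.existsUnique _ _ (h'.linear.comp hθ.inv)
  refine ⟨g, h.hom_ext fun j => ?_, h'.hom_ext fun j => ?_⟩
  · simp [hg j, reassoc_of% hf j]
  · simp [hf j, reassoc_of% hg j]

theorem IsUniversal.of_isIso {E E' : V} {m : ∀ j, E ⊗ P j ⟶ Q j} (h : IsUniversal p q E m)
    {θ : ∀ j, Q j ⟶ Q' j} (hθ : IsModuleHom q q' θ) [∀ j, IsIso (θ j)] (f : E ⟶ E') [IsIso f]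
    {m' : ∀ j, E' ⊗ P j ⟶ Q' j} (hf : ∀ j, f ▷ P j ≫ m' j = m j ≫ θ j) :
    IsUniversal p q' E' m' := by
  have hm : m' = fun j => inv f ▷ P j ≫ m j ≫ θ j := by
    funext j
    rw [← hf j, ← comp_whiskerRight_assoc]
    simp
  subst hm
  refine ⟨(h.linear.comp hθ).whiskerRight (inv f), fun X τ hτ => ?_⟩
  obtain ⟨g, hg, hu⟩ := h.existsUnique X _ (hτ.comp hθ.inv)
  refine ⟨g ≫ f, fun j => ?_, fun k hk => ?_⟩
  · simp only [← comp_whiskerRight_assoc, Category.assoc, IsIso.hom_inv_id, Category.comp_id]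
    rw [reassoc_of% hg j]
    simp
  · rw [← hu (k ≫ inv f) fun j => ?_]
    · simp
    · simp [← hk j]

end Modules

section Cylinders

variable {P : J → V} {p : ∀ i j, P i ⊗ (i ⟶[V] j) ⟶ P j} {T : J → A}
  {t : ∀ i j : J, (i ⟶[V] j) ⟶ (T i ⟶[V] T j)} {l : A} {μ : ∀ j, P j ⟶ (l ⟶[V] T j)}
  {F F' : A → V} {f : ∀ a b, F a ⊗ (a ⟶[V] b) ⟶ F b} {f' : ∀ a b, F' a ⊗ (a ⟶[V] b) ⟶ F' b}

omit [MonoidalClosed V]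

/-- A cylinder `μ : P ⟶ A(l, T -)`. -/
def IsCylinder (p : ∀ i j, P i ⊗ (i ⟶[V] j) ⟶ P j) (t : ∀ i j : J, (i ⟶[V] j) ⟶ (T i ⟶[V] T j))
    (μ : ∀ j, P j ⟶ (l ⟶[V] T j)) : Prop :=
  ∀ i j, p i j ≫ μ j = (μ i ⊗ₘ t i j) ≫ eComp V l (T i) (T j)

/-- The action `f` sends the cylinder `μ` to a limit cylinder. -/
def PreservesCylinder (f : ∀ a b, F a ⊗ (a ⟶[V] b) ⟶ F b) (p : ∀ i j, P i ⊗ (i ⟶[V] j) ⟶ P j)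
    (t : ∀ i j : J, (i ⟶[V] j) ⟶ (T i ⟶[V] T j)) (μ : ∀ j, P j ⟶ (l ⟶[V] T j)) : Prop :=
  IsUniversal p (fun i j => F (T i) ◁ t i j ≫ f (T i) (T j)) (F l) fun j => F l ◁ μ j ≫ f l (T j)

/-- Associativity of the action turns the cylinder equation into linearity, so the content of
`PreservesCylinder` lies in universality alone. -/
theorem IsCylinder.linear (h : IsCylinder p t μ) (hf : IsAction f) :
    IsLinear p (fun i j => F (T i) ◁ t i j ≫ f (T i) (T j)) fun j => F l ◁ μ j ≫ f l (T j) := by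
  intro i j
  rw [← MonoidalCategory.whiskerLeft_comp_assoc, h i j, MonoidalCategory.whiskerLeft_comp_assoc,
    hf.whiskerLeft_eComp]
  simp only [comp_whiskerRight, Category.assoc]
  rw [← whisker_exchange_assoc, MonoidalCategory.tensorHom_def]
  simp

theorem IsCylinder.comp (h : IsCylinder p t μ) (F : EnrichedFunctor V A B) :
    IsCylinder p (fun i j => t i j ≫ F.map _ _) fun j => μ j ≫ F.map l (T j) := by
  intro i j
  rw [reassoc_of% h i j, F.map_comp, tensorHom_comp_tensorHom_assoc]

/-- Preservation depends only on the isomorphism class of the action. This is how homs out of a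
representable are traded for evaluation. -/
theorem PreservesCylinder.of_isModuleHom (h : PreservesCylinder f p t μ)
    {θ : ∀ a, F a ⟶ F' a} (hθ : IsModuleHom f f' θ) (hi : ∀ a, IsIso (θ a)) :
    PreservesCylinder f' p t μ := by
  have : ∀ j, IsIso (θ (T j)) := fun j => hi _
  refine IsUniversal.of_isIso h (θ := fun j => θ (T j)) ?_ (θ l) fun j => ?_
  · intro i j
    rw [Category.assoc, hθ, whisker_exchange_assoc]
  · rw [Category.assoc, hθ, whisker_exchange_assoc]

/-- Restriction of an action along a `V`-functor. -/
theorem IsAction.comp {H : B → V} {h : ∀ a b, H a ⊗ (a ⟶[V] b) ⟶ H b} (hh : IsAction h)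
    (G : EnrichedFunctor V A B) :
    IsAction (F := fun a => H (G.obj a)) fun a b => H (G.obj a) ◁ G.map a b ≫ h _ _ where
  whiskerLeft_eComp a b c := by
    rw [← MonoidalCategory.whiskerLeft_comp_assoc, G.map_comp,
      MonoidalCategory.whiskerLeft_comp_assoc, hh.whiskerLeft_eComp]
    simp only [comp_whiskerRight, Category.assoc]
    rw [← whisker_exchange_assoc, MonoidalCategory.tensorHom_def]
    simp
  whiskerLeft_eId a := by
    rw [← MonoidalCategory.whiskerLeft_comp_assoc, G.map_id, hh.whiskerLeft_eId]

/-- Only functoriality of whiskering is involved: restricting the action along `G` amounts to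
pushing the cylinder forward along `G`. -/
theorem preservesCylinder_comp {H : B → V} {h : ∀ a b, H a ⊗ (a ⟶[V] b) ⟶ H b}
    (G : EnrichedFunctor V A B) :
    PreservesCylinder (F := fun a => H (G.obj a)) (fun a b => H (G.obj a) ◁ G.map a b ≫ h _ _)
        p t μ ↔
      PreservesCylinder (T := fun j => G.obj (T j)) h p (fun i j => t i j ≫ G.map _ _)
        (fun j => μ j ≫ G.map l (T j)) :=
  isUniversal_congr (fun _ _ => (MonoidalCategory.whiskerLeft_comp_assoc _ _ _ _).symm)
    fun _ => (MonoidalCategory.whiskerLeft_comp_assoc _ _ _ _).symm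

end Cylinders

end Action

/-! ### Natural families and ends in terms of actions -/

section Limits

variable {V : Type v} [Category.{u} V] [MonoidalCategory V] [MonoidalClosed V]
variable {J : Type u₁} [EnrichedCategory V J] {A : Type u₂} [EnrichedCategory V A]
  {B : Type u₃} [EnrichedCategory V B]

theorem act_homFunctor (a b c : A) : act (homFunctor a) b c = eComp V a b c :=
  MonoidalClosed.uncurry_curry _

theorem act_comp (T : EnrichedFunctor V J A) (F : EnrichedFunctor V A V) (i j : J) :
    act (T.comp V F) i j = F.obj (T.obj i) ◁ T.map i j ≫ act F (T.obj i) (T.obj j) :=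
  MonoidalClosed.uncurry_natural_left _ _

variable [SymmetricCategory V]

/-- The braiding moves `X` to the left, out of the way of the action of `J` on the right, and
naturality becomes linearity. -/
theorem isNatFamily_iff {F G : EnrichedFunctor V J V} {X : V}
    (σ : ∀ j, X ⟶ (EnrichedCategory.Hom (F.obj j) (G.obj j) : V)) :
    IsNatFamily V F G σ ↔
      IsLinear (act F) (act G) fun j => (β_ X (F.obj j)).hom ≫ MonoidalClosed.uncurry (σ j) := by
  refine forall_congr' fun i => forall_congr' fun j => ?_
  rw [← MonoidalClosed.uncurry_injective.eq_iff, MonoidalClosed.uncurry_natural_left,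
    uncurry_tensor_eComp, uncurry_tensor_eComp, braiding_naturality_right_assoc,
    braiding_tensor_right_hom, comp_whiskerRight]
  simp only [Category.assoc]
  rw [Iso.cancel_iso_inv_left]
  rw [← cancel_epi ((α_ (F.obj i) X (i ⟶[V] j)).hom), ← cancel_epi ((β_ X (F.obj i)).hom ▷ _)]
  simp only [Iso.hom_inv_id_assoc]
  rfl

theorem isNatObj_iff {F G : EnrichedFunctor V J V} {E : V}
    (π : ∀ j, E ⟶ (EnrichedCategory.Hom (F.obj j) (G.obj j) : V)) :
    IsNatObj V F G E π ↔
      IsUniversal (act F) (act G) E fun j =>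
        (β_ E (F.obj j)).hom ≫ MonoidalClosed.uncurry (π j) := by
  have key : ∀ {X : V} (f : X ⟶ E) (σ : ∀ j, X ⟶ (EnrichedCategory.Hom (F.obj j) (G.obj j) : V)) j,
      f ≫ π j = σ j ↔ f ▷ F.obj j ≫ (β_ E (F.obj j)).hom ≫ MonoidalClosed.uncurry (π j) =
        (β_ X (F.obj j)).hom ≫ MonoidalClosed.uncurry (σ j) := by
    intro X f σ j
    rw [braiding_naturality_left_assoc, Iso.cancel_iso_hom_left,
      ← MonoidalClosed.uncurry_natural_left, MonoidalClosed.uncurry_injective.eq_iff]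
  constructor
  · intro h
    refine ⟨(isNatFamily_iff π).1 h.natural, fun X τ hτ => ?_⟩
    obtain ⟨σ, rfl⟩ : ∃ σ : ∀ j, X ⟶ (EnrichedCategory.Hom (F.obj j) (G.obj j) : V),
        τ = fun j => (β_ X (F.obj j)).hom ≫ MonoidalClosed.uncurry (σ j) :=
      ⟨fun j => MonoidalClosed.curry ((β_ X (F.obj j)).inv ≫ τ j), by
        funext j
        rw [MonoidalClosed.uncurry_curry, Iso.hom_inv_id_assoc]⟩
    have := h.existsUnique X _ ((isNatFamily_iff _).2 hτ)
    simpa only [key] using this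
  · intro h
    refine ⟨(isNatFamily_iff π).2 h.linear, fun X σ hσ => ?_⟩
    have := h.existsUnique X _ ((isNatFamily_iff _).1 hσ)
    simpa only [← key] using this

end Limits

/-! ### Weighted limits and their preservation -/

section WeightedLimits

variable {V : Type v} [Category.{u} V] [MonoidalCategory V] [MonoidalClosed V]
variable {J : Type u₁} [EnrichedCategory V J] {A : Type u₂} [EnrichedCategory V A]

/-- The adjunction between `v ⊗ -` and the internal hom absorbs `v` into the parameter object `X`.
-/
theorem isLinear_eComp_iff {φ G : EnrichedFunctor V J V} {v X : V}
    (τ : ∀ j, X ⊗ φ.obj j ⟶ (EnrichedCategory.Hom v (G.obj j) : V)) :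
    IsLinear (act φ) (fun i j => (EnrichedCategory.Hom v (G.obj i) : V) ◁ G.map i j ≫
      eComp V v (G.obj i) (G.obj j)) τ ↔
      IsLinear (act φ) (act G) fun j => (α_ v X (φ.obj j)).hom ≫ MonoidalClosed.uncurry (τ j) := by
  refine forall_congr' fun i => forall_congr' fun j => ?_
  rw [← MonoidalCategory.tensorHom_def_assoc, ← MonoidalClosed.uncurry_injective.eq_iff,
    MonoidalClosed.uncurry_natural_left,
    MonoidalClosed.uncurry_natural_left, uncurry_tensor_eComp, associator_naturality_right_assoc,
    ← cancel_epi (α_ v X (φ.obj i ⊗ (i ⟶[V] j))).hom]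
  simp only [comp_whiskerRight, Category.assoc]
  have hα : (α_ v X (φ.obj i ⊗ (i ⟶[V] j))).hom ≫ v ◁ (α_ X (φ.obj i) (i ⟶[V] j)).inv ≫
      (α_ v (X ⊗ φ.obj i) (i ⟶[V] j)).inv =
        (α_ (v ⊗ X) (φ.obj i) (i ⟶[V] j)).inv ≫ (α_ v X (φ.obj i)).hom ▷ (i ⟶[V] j) := by
    monoidal
  rw [reassoc_of% hα]
  simp [act]

/-- In `V` the test objects `v` are superfluous: by adjunction, testing with `v` and `X` is testing
with the single parameter `v ⊗ X`. -/
theorem preservesCylinder_eComp_iff {φ G : EnrichedFunctor V J V} {l : V}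
    {ν : ∀ j, φ.obj j ⟶ (EnrichedCategory.Hom l (G.obj j) : V)} (hν : IsCylinder (act φ) G.map ν) :
    (∀ v, PreservesCylinder (eComp V v) (act φ) G.map ν) ↔
      IsUniversal (act φ) (act G) l fun j => MonoidalClosed.uncurry (ν j) := by
  have hlin : IsLinear (act φ) (act G) fun j => MonoidalClosed.uncurry (ν j) := by
    intro i j
    have h := congrArg MonoidalClosed.uncurry (hν i j)
    rwa [uncurry_tensor_eComp, MonoidalClosed.uncurry_natural_left] at h
  have key : ∀ {v X : V} (f : X ⟶ (EnrichedCategory.Hom v l : V))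
      (τ : ∀ j, X ⊗ φ.obj j ⟶ (EnrichedCategory.Hom v (G.obj j) : V)) j,
      f ▷ φ.obj j ≫ _ ◁ ν j ≫ eComp V v l (G.obj j) = τ j ↔
      MonoidalClosed.uncurry f ▷ φ.obj j ≫ MonoidalClosed.uncurry (ν j) =
        (α_ v X (φ.obj j)).hom ≫ MonoidalClosed.uncurry (τ j) := by
    intro v X f τ j
    rw [← Iso.inv_comp_eq, ← uncurry_tensor_eComp, MonoidalClosed.uncurry_injective.eq_iff,
      MonoidalCategory.tensorHom_def_assoc]
    rfl
  constructor
  · intro h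
    refine ⟨hlin, fun Y τ hτ => ?_⟩
    -- A parameter `Y` is recovered from the test object `v = Y` with `X` the unit, through `Y ⊗ 𝟙_
    -- V ≅ Y`.
    have hl := (isLinear_eComp_iff (G := G) (φ := φ) (v := Y) (X := 𝟙_ V)
      (fun j => (λ_ _).hom ≫ MonoidalClosed.curry (τ j))).2 ?_
    · obtain ⟨f, hf, hu⟩ := (h Y).existsUnique _ _ hl
      refine ⟨(ρ_ Y).inv ≫ MonoidalClosed.uncurry f, fun j => ?_, fun g hg => ?_⟩
      · have := (key f (fun j => (λ_ _).hom ≫ MonoidalClosed.curry (τ j)) j).1 (hf j)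
        simp only [comp_whiskerRight, Category.assoc]
        rw [this, MonoidalClosed.uncurry_natural_left, MonoidalClosed.uncurry_curry]
        simp
      · rw [← hu (MonoidalClosed.curry ((ρ_ Y).hom ≫ g)) fun j =>
            (key _ (fun j => (λ_ _).hom ≫ MonoidalClosed.curry (τ j)) j).2 ?_]
        · rw [MonoidalClosed.uncurry_curry, Iso.inv_hom_id_assoc]
        · rw [MonoidalClosed.uncurry_curry, MonoidalClosed.uncurry_natural_left,
            MonoidalClosed.uncurry_curry, comp_whiskerRight_assoc, hg]
          simp
    · have := hτ.whiskerRight (ρ_ Y).hom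
      convert! this using 2 with j
      rw [MonoidalClosed.uncurry_natural_left, MonoidalClosed.uncurry_curry]
      simp
  · intro h v
    refine ⟨hν.linear (isAction_eComp v), fun X τ hτ => ?_⟩
    obtain ⟨f, hf, hu⟩ := h.existsUnique _ _ ((isLinear_eComp_iff τ).1 hτ)
    refine ⟨MonoidalClosed.curry f, fun j => (key _ _ _).2 ?_, fun g hg => ?_⟩
    · rw [MonoidalClosed.uncurry_curry]
      exact hf j
    · rw [← hu (MonoidalClosed.uncurry g) fun j => (key _ _ _).1 (hg j),
        MonoidalClosed.curry_uncurry]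

variable [SymmetricCategory V]

theorem isNatObj_limitTransform_iff {φ : EnrichedFunctor V J V} {T : EnrichedFunctor V J A} {l : A}
    {μ : ∀ j, φ.obj j ⟶ (l ⟶[V] T.obj j)} (a : A) :
    IsNatObj V φ (T.comp V (homFunctor a)) (a ⟶[V] l) (limitTransform φ T μ a) ↔
      PreservesCylinder (eComp V a) (act φ) T.map μ := by
  refine (isNatObj_iff (G := T.comp V (homFunctor a)) (limitTransform φ T μ a)).trans
    (isUniversal_congr (fun i j => (act_comp _ _ i j).trans ?_) fun j => ?_)
  · rw [act_homFunctor]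
    rfl
  · exact (congrArg ((β_ (a ⟶[V] l) (φ.obj j)).hom ≫ ·) (MonoidalClosed.uncurry_curry _)).trans
      (SymmetricCategory.symmetry_assoc _ _ _)

/-- The definition of a weighted limit does not ask that `μ` be a cylinder. This comes from
linearity at `a = l`, restricted along the identity of `l`. -/
theorem isWeightedLimit_iff {φ : EnrichedFunctor V J V} {T : EnrichedFunctor V J A} {l : A}
    {μ : ∀ j, φ.obj j ⟶ (l ⟶[V] T.obj j)} :
    IsWeightedLimit φ T l μ ↔
      IsCylinder (act φ) T.map μ ∧ ∀ a, PreservesCylinder (eComp V a) (act φ) T.map μ := by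
  have h : IsWeightedLimit φ T l μ ↔ ∀ a, PreservesCylinder (eComp V a) (act φ) T.map μ :=
    forall_congr' isNatObj_limitTransform_iff
  rw [h, iff_and_self]
  intro h i j
  have e := (λ_ _).inv ≫= (h l).linear.whiskerRight (eId V l) i j
  have e' : ∀ j, eId V l ▷ φ.obj j ≫ (l ⟶[V] l) ◁ μ j ≫ eComp V l l (T.obj j) =
      (λ_ _).hom ≫ μ j := by
    intro j
    rw [← whisker_exchange_assoc, ← Iso.inv_comp_eq, ← leftUnitor_inv_naturality_assoc, e_id_comp,
      Category.comp_id]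
  beta_reduce at e
  rw [e', e'] at e
  rw [MonoidalCategory.tensorHom_def_assoc]
  simpa using e

theorem isWeightedLimit_comp_iff {φ : EnrichedFunctor V J V} {T : EnrichedFunctor V J A} {l : A}
    {μ : ∀ j, φ.obj j ⟶ (l ⟶[V] T.obj j)} (hμ : IsCylinder (act φ) T.map μ)
    (F : EnrichedFunctor V A V) :
    IsWeightedLimit φ (T.comp V F) (F.obj l) (fun j => μ j ≫ F.map l (T.obj j)) ↔
      PreservesCylinder (act F) (act φ) T.map μ := by
  refine isWeightedLimit_iff.trans ((and_iff_right (hμ.comp F)).trans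
    ((preservesCylinder_eComp_iff (G := T.comp V F) (hμ.comp F)).trans ?_))
  exact isUniversal_congr (act_comp _ _) fun j => MonoidalClosed.uncurry_natural_left _ _

end WeightedLimits

/-! ### Exchange of tensor factors -/

section Swap

variable {V : Type v} [Category.{u} V] [MonoidalCategory V] [SymmetricCategory V]

/-- The exchange of the last two factors of a threefold tensor product. -/
def swapRight (X Y Z : V) : (X ⊗ Y) ⊗ Z ⟶ (X ⊗ Z) ⊗ Y :=
  (α_ X Y Z).hom ≫ X ◁ (β_ Y Z).hom ≫ (α_ X Z Y).inv

theorem swapRight_swapRight (X Y Z : V) : swapRight X Y Z ≫ swapRight X Z Y = 𝟙 _ := by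
  simp [swapRight, ← MonoidalCategory.whiskerLeft_comp_assoc]

theorem swapRight_naturality_left {X X' : V} (f : X ⟶ X') (Y Z : V) :
    (f ▷ Y) ▷ Z ≫ swapRight X' Y Z = swapRight X Y Z ≫ (f ▷ Z) ▷ Y := by
  simp only [swapRight, Category.assoc]
  rw [associator_naturality_left_assoc, ← whisker_exchange_assoc, associator_inv_naturality_left]

theorem swapRight_naturality_middle (X : V) {Y Y' : V} (f : Y ⟶ Y') (Z : V) :
    (X ◁ f) ▷ Z ≫ swapRight X Y' Z = swapRight X Y Z ≫ (X ⊗ Z) ◁ f := by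
  simp only [swapRight, Category.assoc]
  rw [associator_naturality_middle_assoc, ← MonoidalCategory.whiskerLeft_comp_assoc,
    braiding_naturality_left, MonoidalCategory.whiskerLeft_comp_assoc,
    associator_inv_naturality_right]

theorem swapRight_naturality_right (X Y : V) {Z Z' : V} (f : Z ⟶ Z') :
    (X ⊗ Y) ◁ f ≫ swapRight X Y Z' = swapRight X Y Z ≫ (X ◁ f) ▷ Y := by
  simp only [swapRight, Category.assoc]
  rw [associator_naturality_right_assoc, ← MonoidalCategory.whiskerLeft_comp_assoc,
    braiding_naturality_right, MonoidalCategory.whiskerLeft_comp_assoc,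
    associator_inv_naturality_middle]

/-- A hexagon identity. Symmetry is needed because `Y` passes `W` and then returns. -/
theorem swapRight_tensor_right (X Y Z W : V) :
    swapRight X Y (Z ⊗ W) ≫ (α_ X Z W).inv ▷ Y ≫ swapRight (X ⊗ Z) W Y =
      (α_ (X ⊗ Y) Z W).inv ≫ swapRight X Y Z ▷ W := by
  have h : (X ⊗ Z) ◁ (β_ W Y).hom = (X ⊗ Z) ◁ (β_ Y W).inv := by
    rw [SymmetricCategory.braiding_swap_eq_inv_braiding]
  simp only [swapRight, h, braiding_tensor_right_hom]
  simp

theorem swapRight_tensor_middle (X Y Z W : V) :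
    swapRight X (Y ⊗ Z) W ≫ (α_ (X ⊗ W) Y Z).inv =
      (α_ X Y Z).inv ▷ W ≫ swapRight (X ⊗ Y) Z W ≫ swapRight X Y W ▷ Z := by
  simp only [swapRight, braiding_tensor_left_hom]
  simp

end Swap

/-! ### Interchange of limits -/

section Interchange

variable {V : Type v} [Category.{u} V] [MonoidalCategory V] [SymmetricCategory V]
variable {I : Type u₁} [EnrichedCategory V I] {J : Type u₂} [EnrichedCategory V J]
  {A : Type u₃} [EnrichedCategory V A]

/-- Limits commute with limits: a pointwise limit of functors which preserve a limit cylinder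
preserves this cylinder. -/
theorem PreservesCylinder.of_pointwise {P : J → V} {p : ∀ i j : J, P i ⊗ (i ⟶[V] j) ⟶ P j}
    {S : J → A → V} {s : ∀ j, ∀ a b : A, S j a ⊗ (a ⟶[V] b) ⟶ S j b}
    {r : ∀ a, ∀ i j : J, S i a ⊗ (i ⟶[V] j) ⟶ S j a}
    (hrs : ∀ i j a b, r a i j ▷ (a ⟶[V] b) ≫ s j a b =
      swapRight _ _ _ ≫ s i a b ▷ (i ⟶[V] j) ≫ r b i j)
    {F : A → V} {f : ∀ a b : A, F a ⊗ (a ⟶[V] b) ⟶ F b} (hf : IsAction f)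
    {m : ∀ j a, F a ⊗ P j ⟶ S j a}
    (hm : ∀ j a b, m j a ▷ (a ⟶[V] b) ≫ s j a b = swapRight _ _ _ ≫ f a b ▷ P j ≫ m j b)
    (hu : ∀ a, IsUniversal p (r a) (F a) fun j => m j a)
    {Q : I → V} {q : ∀ i j : I, Q i ⊗ (i ⟶[V] j) ⟶ Q j} {T : I → A}
    {t : ∀ i j : I, (i ⟶[V] j) ⟶ (T i ⟶[V] T j)} {l : A} {ν : ∀ i, Q i ⟶ (l ⟶[V] T i)}
    (hν : IsCylinder q t ν) (hS : ∀ j, PreservesCylinder (s j) q t ν) :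
    PreservesCylinder f q t ν := by
  have hm' : ∀ j a b, f a b ▷ P j ≫ m j b = swapRight _ _ _ ≫ m j a ▷ (a ⟶[V] b) ≫ s j a b := by
    intro j a b
    rw [hm, reassoc_of% swapRight_swapRight (V := V)]
  -- Projecting along `m` and restricting along `ν` commute up to the exchange. This links the two
  -- universal properties in both the existence and the uniqueness argument.
  have key : ∀ {X : V} (h : X ⟶ F l) j i,
      (h ▷ P j ≫ m j l) ▷ Q i ≫ S j l ◁ ν i ≫ s j l (T i) =
        swapRight _ _ _ ≫ (h ▷ Q i ≫ F l ◁ ν i ≫ f l (T i)) ▷ P j ≫ m j (T i) := by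
    intro X h j i
    simp only [comp_whiskerRight, Category.assoc]
    rw [hm', reassoc_of% swapRight_naturality_middle (V := V),
      reassoc_of% swapRight_naturality_left (V := V),
      reassoc_of% swapRight_swapRight (V := V), whisker_exchange_assoc]
  refine ⟨hν.linear hf, fun X τ hτ => ?_⟩
  have h₁ : ∀ j, IsLinear q (fun i k => S j (T i) ◁ t i k ≫ s j (T i) (T k))
      fun i => swapRight X (P j) (Q i) ≫ τ i ▷ P j ≫ m j (T i) := by
    intro j i k
    rw [reassoc_of% swapRight_naturality_right (V := V), ← comp_whiskerRight_assoc, hτ i k]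
    simp only [comp_whiskerRight, Category.assoc]
    rw [hm', reassoc_of% swapRight_naturality_middle (V := V),
      reassoc_of% swapRight_naturality_left (V := V),
      reassoc_of% swapRight_tensor_right (V := V), whisker_exchange_assoc]
  -- For each `j` the projected family is linear in `i`, so it factors through the limit `S j l`.
  choose g hg hgu using fun j => (hS j).existsUnique _ _ (h₁ j)
  -- Linearity in `j` can be checked after composing with the limit cylinders of the `S j`, where it
  -- reduces to linearity of `m` at the objects `T k`. The arrows `g j` then assemble to `X ⟶ F l`.
  have h₂ : IsLinear p (r l) g := by
    intro i j
    refine (hS j).hom_ext fun k => ?_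
    rw [comp_whiskerRight_assoc, hg j k, reassoc_of% swapRight_naturality_middle (V := V),
      whisker_exchange_assoc,
      (hu (T k)).linear i j]
    simp only [comp_whiskerRight, Category.assoc]
    rw [← whisker_exchange_assoc, hrs, reassoc_of% swapRight_naturality_right (V := V),
      reassoc_of% swapRight_naturality_left (V := V), ← comp_whiskerRight_assoc,
      ← comp_whiskerRight_assoc,
      Category.assoc, hg i k]
    simp only [comp_whiskerRight, Category.assoc]
    rw [← reassoc_of% swapRight_tensor_middle (V := V), associator_inv_naturality_left_assoc]
  obtain ⟨h, hh, hhu⟩ := (hu l).existsUnique _ _ h₂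
  refine ⟨h, fun i => (hu (T i)).hom_ext fun j => ?_, fun k hk => hhu k fun j => ?_⟩
  · have := swapRight _ _ _ ≫= key h j i
    rw [hh j, hg j i, reassoc_of% swapRight_swapRight (V := V),
      reassoc_of% swapRight_swapRight (V := V)] at this
    exact this.symm
  · refine hgu j _ fun i => ?_
    rw [key, hk i]

end Interchange

/-! ### Evaluation, the Yoneda lemma and pointwise limits -/

section FunctorCategory

variable {V : Type v} [Category.{u} V] [MonoidalCategory V] [SymmetricCategory V]
  [MonoidalClosed V]
variable {J : Type u₁} [EnrichedCategory V J] {A : Type u₂} [EnrichedCategory V A]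

/-- In contrast to `isNatFamily_iff`, `X` stays on the right of `F a`, so naturality says that two
right actions commute. -/
theorem isNatFamily_iff_act {F G : EnrichedFunctor V A V} {X : V}
    (σ : ∀ a, X ⟶ (EnrichedCategory.Hom (F.obj a) (G.obj a) : V)) :
    IsNatFamily V F G σ ↔ ∀ a b, MonoidalClosed.uncurry (σ a) ▷ (a ⟶[V] b) ≫ act G a b =
      swapRight _ _ _ ≫ act F a b ▷ X ≫ MonoidalClosed.uncurry (σ b) := by
  refine forall_congr' fun i => forall_congr' fun j => ?_
  rw [← MonoidalClosed.uncurry_injective.eq_iff, MonoidalClosed.uncurry_natural_left,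
    uncurry_tensor_eComp, uncurry_tensor_eComp, eq_comm, Iso.inv_comp_eq]
  simp only [swapRight, Category.assoc]
  rfl

variable [HasLimits V]

/-- The action of the functor category `[A, V]` on the values of functors at `a`. -/
def evalAct [IsSmall V A] (a : A) (F G : EnrichedFunctor V A V) :
    F.obj a ⊗ (F ⟶[V] G) ⟶ G.obj a :=
  MonoidalClosed.uncurry (natProj F G a)

variable [IsSmall V A]

theorem whiskerLeft_natLift_evalAct {F G : EnrichedFunctor V A V} {X : V}
    (σ : ∀ a : A, X ⟶ (EnrichedCategory.Hom (F.obj a) (G.obj a) : V)) (hσ : IsNatFamily V F G σ)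
    (a : A) : F.obj a ◁ (natLift σ hσ : X ⟶ (F ⟶[V] G)) ≫ evalAct a F G =
      MonoidalClosed.uncurry (σ a) := by
  rw [← natLift_natProj σ hσ a]
  exact (MonoidalClosed.uncurry_natural_left _ _).symm

theorem isAction_evalAct (a : A) :
    IsAction (A := EnrichedFunctor V A V) (F := fun F => F.obj a) (evalAct a) :=
  isAction_act (evalFunctor a)

theorem evalAct_whiskerRight_act (F G : EnrichedFunctor V A V) (a b : A) :
    evalAct a F G ▷ (a ⟶[V] b) ≫ act G a b =
      swapRight _ _ _ ≫ act F a b ▷ _ ≫ evalAct b F G :=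
  (isNatFamily_iff_act _).1 (isNatObj_natObj F G).natural a b

theorem isUniversal_evalAct (F G : EnrichedFunctor V A V) :
    IsUniversal (act F) (act G) (F ⟶[V] G) fun a => (β_ _ _).hom ≫ evalAct a F G :=
  (isNatObj_iff _).1 (isNatObj_natObj F G)

omit [HasLimits V] [IsSmall V A] [SymmetricCategory V] [MonoidalClosed V] in
/-- The Yoneda lemma. -/
theorem isUniversal_eComp (a : A) {F : A → V} {f : ∀ a b : A, F a ⊗ (a ⟶[V] b) ⟶ F b}
    (hf : IsAction f) : IsUniversal (eComp V a) f (F a) (f a) := by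
  refine ⟨fun b c => hf.whiskerLeft_eComp a b c, fun X τ hτ =>
    -- The value of `τ` at the identity of `a`, as in the ordinary Yoneda lemma.
    ⟨(ρ_ X).inv ≫ X ◁ eId V a ≫ τ a, fun b => ?_, fun g hg => ?_⟩⟩
  · have h := hτ a b
    rw [eq_comm, Iso.inv_comp_eq] at h
    simp only [comp_whiskerRight, Category.assoc]
    rw [h, associator_naturality_middle_assoc, ← MonoidalCategory.whiskerLeft_comp_assoc]
    have e : eId V a ▷ (a ⟶[V] b) ≫ eComp V a a b = (λ_ _).hom := by
      rw [← cancel_epi (λ_ _).inv, e_id_comp, Iso.inv_hom_id]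
    rw [e]
    simp
  · rw [← hg a, whisker_exchange_assoc, hf.whiskerLeft_eId, rightUnitor_naturality,
      Iso.inv_hom_id_assoc]

/-- The evaluation `A(a, b) ⊗ [A, V](A(a, -), G) ⟶ G b`. -/
def homEvalAct (a b : A) (G : EnrichedFunctor V A V) :
    (a ⟶[V] b) ⊗ (homFunctor a ⟶[V] G) ⟶ G.obj b :=
  evalAct b (homFunctor a) G

theorem homEvalAct_whiskerRight_act (a b c : A) (G : EnrichedFunctor V A V) :
    homEvalAct a b G ▷ (b ⟶[V] c) ≫ act G b c =
      swapRight _ _ _ ≫ eComp V a b c ▷ _ ≫ homEvalAct a c G := by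
  refine (evalAct_whiskerRight_act (homFunctor a) G b c).trans ?_
  rw [act_homFunctor]
  rfl

theorem whiskerLeft_eComp_homEvalAct (a b : A) (G H : EnrichedFunctor V A V) :
    (a ⟶[V] b) ◁ eComp V (homFunctor a) G H ≫ homEvalAct a b H =
      (α_ _ _ _).inv ≫ homEvalAct a b G ▷ _ ≫ evalAct b G H :=
  (isAction_evalAct b).whiskerLeft_eComp (homFunctor a) G H

theorem isUniversal_homEvalAct (a : A) (G : EnrichedFunctor V A V) :
    IsUniversal (eComp V a) (act G) (homFunctor a ⟶[V] G) fun b =>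
      (β_ _ _).hom ≫ homEvalAct a b G := by
  have h := isUniversal_evalAct (homFunctor a) G
  have e : act (homFunctor a) = eComp V a := funext fun b => funext fun c => act_homFunctor a b c
  rw [e] at h
  exact h

/-- The evaluation `[A, V](A(a, -), G) ⟶ G a` at the identity. -/
def evalId (a : A) (G : EnrichedFunctor V A V) : (homFunctor a ⟶[V] G) ⟶ G.obj a :=
  (λ_ _).inv ≫ eId V a ▷ _ ≫ homEvalAct a a G

theorem evalId_whiskerRight_act (a : A) (G : EnrichedFunctor V A V) (b : A) :
    evalId a G ▷ (a ⟶[V] b) ≫ act G a b = (β_ _ _).hom ≫ homEvalAct a b G := by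
  have e : eId V a ▷ (a ⟶[V] b) ≫ eComp V a a b = (λ_ _).hom := by
    rw [← cancel_epi (λ_ _).inv, e_id_comp, Iso.inv_hom_id]
  have hc : (λ_ (homFunctor a ⟶[V] G)).inv ▷ (a ⟶[V] b) ≫ swapRight _ _ _ ≫
      (λ_ (a ⟶[V] b)).hom ▷ _ = (β_ _ _).hom := by
    simp [swapRight]
  dsimp only [evalId]
  simp only [comp_whiskerRight, Category.assoc]
  rw [homEvalAct_whiskerRight_act, reassoc_of% swapRight_naturality_left (V := V),
    ← comp_whiskerRight_assoc, e,
    reassoc_of% hc]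

/-- Both objects are universal for linear families out of `A(a, -)`: one as a hom object of `[A,
V]`, the other by Yoneda. -/
instance isIso_evalId (a : A) (G : EnrichedFunctor V A V) : IsIso (evalId a G) := by
  refine (isUniversal_homEvalAct a G).isIso (isUniversal_eComp a (isAction_act G))
    (θ := fun b => 𝟙 _) (fun b c => by simp) _ fun b => ?_
  rw [evalId_whiskerRight_act, Category.comp_id]

theorem isModuleHom_evalId (a : A) :
    IsModuleHom (eComp V (homFunctor a : EnrichedFunctor V A V)) (evalAct a) (evalId a) := by
  intro G H
  dsimp only [evalId]
  rw [leftUnitor_inv_naturality_assoc, whisker_exchange_assoc, whiskerLeft_eComp_homEvalAct]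
  simp only [comp_whiskerRight, Category.assoc]
  rw [associator_inv_naturality_left_assoc]
  simp

/-- Evaluation at `a` is isomorphic to the hom-functor out of `A(a, -)`, and hom-functors preserve
limits. Hence any limit in `[A, V]` is pointwise. -/
theorem PreservesCylinder.eval {P : J → V} {p : ∀ i j : J, P i ⊗ (i ⟶[V] j) ⟶ P j}
    {T : J → EnrichedFunctor V A V} {t : ∀ i j : J, (i ⟶[V] j) ⟶ (T i ⟶[V] T j)}
    {l : EnrichedFunctor V A V} {μ : ∀ j, P j ⟶ (l ⟶[V] T j)} (a : A)
    (h : PreservesCylinder (eComp V (homFunctor a : EnrichedFunctor V A V)) p t μ) :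
    PreservesCylinder (F := fun F : EnrichedFunctor V A V => F.obj a)
      (evalAct a) p t μ :=
  h.of_isModuleHom (isModuleHom_evalId a) fun G => isIso_evalId a G

/-- The functors which preserve a limit cylinder are closed under limits. -/
theorem PreservesCylinder.of_isWeightedLimit {φ : EnrichedFunctor V J V}
    {S : EnrichedFunctor V J (EnrichedFunctor V A V)} {F : EnrichedFunctor V A V}
    {μ : ∀ j, φ.obj j ⟶ (F ⟶[V] S.obj j)} (hF : IsWeightedLimit φ S F μ)
    {I : Type u₃} [EnrichedCategory V I] {Q : I → V} {q : ∀ i j : I, Q i ⊗ (i ⟶[V] j) ⟶ Q j}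
    {T : I → A} {t : ∀ i j : I, (i ⟶[V] j) ⟶ (T i ⟶[V] T j)} {l : A} {ν : ∀ i, Q i ⟶ (l ⟶[V] T i)}
    (hν : IsCylinder q t ν) (hS : ∀ j, PreservesCylinder (act (S.obj j)) q t ν) :
    PreservesCylinder (act F) q t ν := by
  rw [isWeightedLimit_iff] at hF
  refine PreservesCylinder.of_pointwise (s := fun j => act (S.obj j)) (fun i j a b => ?_)
    (isAction_act F) (fun j a b => ?_) (fun a => (hF.2 (homFunctor a)).eval a) hν hS
  · simp only [comp_whiskerRight, Category.assoc]
    rw [evalAct_whiskerRight_act, reassoc_of% swapRight_naturality_middle (V := V),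
      whisker_exchange_assoc]
  · simp only [comp_whiskerRight, Category.assoc]
    rw [evalAct_whiskerRight_act, reassoc_of% swapRight_naturality_middle (V := V),
      whisker_exchange_assoc]

end FunctorCategory

/-! ### Transposing `L ⟶ [A, V]` to `A ⟶ [L, V]` -/

section Transpose

variable {V : Type v} [Category.{u} V] [MonoidalCategory V] [SymmetricCategory V]
  [MonoidalClosed V] [HasLimits V]
variable {L : Type u₁} [EnrichedCategory V L] [IsSmall V L]
  {A : Type u₂} [EnrichedCategory V A] [IsSmall V A]

omit [IsSmall V L] in
theorem act_comp_evalFunctor (S : EnrichedFunctor V L (EnrichedFunctor V A V)) (a : A) (x y : L) :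
    act (S.comp V (evalFunctor a)) x y =
      (S.obj x).obj a ◁ S.map x y ≫ evalAct a (S.obj x) (S.obj y) :=
  act_comp _ _ _ _

omit [IsSmall V L] in
theorem evalAct_comp_whiskerRight_act (S : EnrichedFunctor V L (EnrichedFunctor V A V))
    (x y : L) (a b : A) :
    ((S.obj x).obj a ◁ S.map x y ≫ evalAct a (S.obj x) (S.obj y)) ▷ (a ⟶[V] b) ≫
        act (S.obj y) a b =
      swapRight _ _ _ ≫ act (S.obj x) a b ▷ (x ⟶[V] y) ≫
        (S.obj x).obj b ◁ S.map x y ≫ evalAct b (S.obj x) (S.obj y) := by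
  simp only [comp_whiskerRight, Category.assoc]
  rw [evalAct_whiskerRight_act, reassoc_of% swapRight_naturality_middle (V := V),
    whisker_exchange_assoc]

-- The actions of `L` and `A` on the values of `S` commute, and this condition is symmetric in the
-- two variables.
omit [IsSmall V L] in
theorem isNatFamily_map (S : EnrichedFunctor V L (EnrichedFunctor V A V)) (a b : A) :
    IsNatFamily V (S.comp V (evalFunctor a)) (S.comp V (evalFunctor b))
      fun x => (S.obj x).map a b := by
  refine (isNatFamily_iff_act (F := S.comp V (evalFunctor a)) (G := S.comp V (evalFunctor b))
    (fun x => (S.obj x).map a b)).2 fun x y => ?_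
  rw [act_comp_evalFunctor, act_comp_evalFunctor]
  have h := swapRight _ _ _ ≫= evalAct_comp_whiskerRight_act S x y a b
  rw [reassoc_of% swapRight_swapRight (V := V)] at h
  exact h.symm

/-- The transpose `A ⟶ [L, V]` of a `V`-functor `L ⟶ [A, V]`. -/
def transpose (S : EnrichedFunctor V L (EnrichedFunctor V A V)) :
    EnrichedFunctor V A (EnrichedFunctor V L V) where
  obj a := S.comp V (evalFunctor a)
  map a b := natLift _ (isNatFamily_map S a b)
  map_id a := by
    refine (isNatObj_natObj _ _).hom_ext fun x => (Category.assoc _ _ _).trans ?_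
    refine (congrArg (eId V a ≫ ·) (natLift_natProj _ (isNatFamily_map S a a) x)).trans ?_
    exact ((S.obj x).map_id a).trans
      ((evalFunctor x).map_id (S.comp V (evalFunctor a) : EnrichedFunctor V L V)).symm
  map_comp a b c := by
    refine (isNatObj_natObj _ _).hom_ext fun x => (Category.assoc _ _ _).trans ?_
    refine (congrArg (eComp V a b c ≫ ·) (natLift_natProj _ (isNatFamily_map S a c) x)).trans ?_
    refine ((S.obj x).map_comp a b c).trans (Eq.trans ?_ (Category.assoc _ _ _).symm)
    have h := (evalFunctor x).map_comp (S.comp V (evalFunctor a) : EnrichedFunctor V L V)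
      (S.comp V (evalFunctor b)) (S.comp V (evalFunctor c))
    refine Eq.trans ?_ (congrArg ((natLift _ (isNatFamily_map S a b) ⊗ₘ
      natLift _ (isNatFamily_map S b c)) ≫ ·) h).symm
    refine Eq.trans ?_ (Category.assoc _ _ _)
    refine congrArg (· ≫ eComp V ((S.obj x).obj a) ((S.obj x).obj b) ((S.obj x).obj c)) ?_
    refine Eq.trans ?_ (tensorHom_comp_tensorHom (natLift _ (isNatFamily_map S a b))
      (natLift _ (isNatFamily_map S b c)) (natProj _ _ x) (natProj _ _ x)).symm
    exact congrArg₂ (· ⊗ₘ ·) (natLift_natProj _ (isNatFamily_map S a b) x).symm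
      (natLift_natProj _ (isNatFamily_map S b c) x).symm

theorem whiskerLeft_transpose_map (S : EnrichedFunctor V L (EnrichedFunctor V A V)) (a b : A)
    (x : L) :
    (S.obj x).obj a ◁ (transpose S).map a b ≫
      evalAct x ((transpose S).obj a) ((transpose S).obj b) =
      act (S.obj x) a b :=
  whiskerLeft_natLift_evalAct _ (isNatFamily_map S a b) x

omit [IsSmall V A] in
theorem whiskerLeft_comp_evalAct (H : EnrichedFunctor V A (EnrichedFunctor V L V))
    (G : EnrichedFunctor V L V) (x : L) (a b : A) :
    G.obj x ◁ ((G ⟶[V] H.obj a) ◁ H.map a b ≫ eComp V G (H.obj a) (H.obj b)) ≫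
        evalAct x G (H.obj b) =
      (α_ _ _ _).inv ≫ evalAct x G (H.obj a) ▷ _ ≫
        (H.obj a).obj x ◁ H.map a b ≫ evalAct x (H.obj a) (H.obj b) := by
  rw [MonoidalCategory.whiskerLeft_comp_assoc, (isAction_evalAct x).whiskerLeft_eComp,
    associator_inv_naturality_right_assoc, whisker_exchange_assoc]

/-- The evaluation `G x ⊗ [L, V](G, S - a) ⟶ S x a`. -/
def transposeEval (S : EnrichedFunctor V L (EnrichedFunctor V A V)) (G : EnrichedFunctor V L V)
    (x : L) (a : A) : G.obj x ⊗ (G ⟶[V] (transpose S).obj a) ⟶ (S.obj x).obj a :=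
  evalAct x G ((transpose S).obj a)

theorem whiskerLeft_comp_transposeEval (S : EnrichedFunctor V L (EnrichedFunctor V A V))
    (G : EnrichedFunctor V L V) (x : L) (a b : A) :
    G.obj x ◁ ((G ⟶[V] (transpose S).obj a) ◁ (transpose S).map a b ≫ eComp V G _ _) ≫
        transposeEval S G x b =
      (α_ _ _ _).inv ≫ transposeEval S G x a ▷ _ ≫ act (S.obj x) a b := by
  refine (whiskerLeft_comp_evalAct (transpose S) G x a b).trans ?_
  exact congrArg (fun k => (α_ _ _ _).inv ≫ transposeEval S G x a ▷ _ ≫ k)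
    (whiskerLeft_transpose_map S a b x)

/-- A pointwise limit in a functor category is a limit. -/
theorem preservesCylinder_transpose {S : EnrichedFunctor V L (EnrichedFunctor V A V)}
    {I : Type u₃} [EnrichedCategory V I] {Q : I → V} {q : ∀ i j : I, Q i ⊗ (i ⟶[V] j) ⟶ Q j}
    {T : I → A} {t : ∀ i j : I, (i ⟶[V] j) ⟶ (T i ⟶[V] T j)} {l : A} {ν : ∀ i, Q i ⟶ (l ⟶[V] T i)}
    (hν : IsCylinder q t ν) (hS : ∀ x, PreservesCylinder (act (S.obj x)) q t ν)
    (G : EnrichedFunctor V L V) :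
    PreservesCylinder (T := fun i => (transpose S).obj (T i)) (eComp V G) q
      (fun i j => t i j ≫ (transpose S).map _ _)
      (fun i => ν i ≫ (transpose S).map l (T i)) := by
  rw [← preservesCylinder_comp (transpose S)]
  -- The hom object `[L, V](G, S - a)` is the limit of the `S x a` weighted by `G`. The functor of
  -- `a` in question is thus a pointwise limit of the `S x`, and interchange applies.
  refine PreservesCylinder.of_pointwise (s := fun x => act (S.obj x)) (p := act G)
    (m := fun x a => (β_ _ _).hom ≫ transposeEval S G x a)
    (fun i j a b => evalAct_comp_whiskerRight_act S i j a b)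
    ((isAction_eComp G).comp _) (fun x a b => ?_) (fun a => ?_) hν hS
  · have e : swapRight (G ⟶[V] (transpose S).obj a) (G.obj x) (a ⟶[V] b) ≫
        (β_ _ _).hom ≫ (α_ _ _ _).inv = (β_ _ _).hom ▷ _ := by
      rw [braiding_tensor_left_hom]
      simp [swapRight, ← MonoidalCategory.whiskerLeft_comp_assoc]
    rw [braiding_naturality_left_assoc, whiskerLeft_comp_transposeEval, reassoc_of% e,
      comp_whiskerRight_assoc]
  · have h := isUniversal_evalAct G ((transpose S).obj a)
    have e : act ((transpose S).obj a) = fun x y =>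
        (S.obj x).obj a ◁ S.map x y ≫ evalAct a (S.obj x) (S.obj y) :=
      funext fun x => funext fun y => act_comp_evalFunctor S a x y
    rw [e] at h
    exact h

theorem isWeightedLimit_transpose {S : EnrichedFunctor V L (EnrichedFunctor V A V)}
    {I : Type u₃} [EnrichedCategory V I] {ψ : EnrichedFunctor V I V}
    {T : EnrichedFunctor V I A} {l : A} {ν : ∀ i, ψ.obj i ⟶ (l ⟶[V] T.obj i)}
    (hν : IsCylinder (act ψ) T.map ν)
    (hS : ∀ x, PreservesCylinder (act (S.obj x)) (act ψ) T.map ν) :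
    IsWeightedLimit ψ (T.comp V (transpose S)) ((transpose S).obj l)
      (fun i => ν i ≫ (transpose S).map l (T.obj i)) :=
  isWeightedLimit_iff.2 ⟨hν.comp _, fun G => preservesCylinder_transpose hν hS G⟩

end Transpose

/-! ### Pointwise colimits -/

section PointwiseColimits

variable {V : Type v} [Category.{u} V] [MonoidalCategory V] [SymmetricCategory V]
  [MonoidalClosed V]

/-- Translates the universal property of a colimit, stated in the opposite of `V`, into equations
about the coprojections `b ⊗ Y ⟶ c`. -/
theorem whiskerRight_eComp_op_iff {b c v X Y : V} (f : X ⟶ (EnrichedCategory.Hom c v : V))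
    (e : Y ⟶ (EnrichedCategory.Hom b c : V)) (g : X ⊗ Y ⟶ (EnrichedCategory.Hom b v : V)) :
    f ▷ Y ≫ (EnrichedCategory.Hom c v : V) ◁ e ≫ eComp V (op v) (op c) (op b) = g ↔
      b ◁ (β_ X Y).hom ≫ (α_ _ _ _).inv ≫ MonoidalClosed.uncurry e ▷ X ≫
        MonoidalClosed.uncurry f = MonoidalClosed.uncurry g := by
  have h : f ▷ Y ≫ (EnrichedCategory.Hom c v : V) ◁ e ≫ eComp V (op v) (op c) (op b) =
      (β_ X Y).hom ≫ (e ⊗ₘ f) ≫ eComp V b c v := by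
    rw [← tensorHom_eComp_op_eq V (x := op b) (y := op c) (z := op v),
      MonoidalCategory.tensorHom_def_assoc]
    rfl
  rw [h, ← MonoidalClosed.uncurry_injective.eq_iff, MonoidalClosed.uncurry_natural_left,
    uncurry_tensor_eComp]

variable {L : Type u₁} [EnrichedCategory V L] {φ : EnrichedFunctor V Lᵒᵖ V}

/-- The coprojections of a colimit in `V` stay jointly epic after tensoring with any `X`, since the
enriched universal property admits `X` as a parameter. -/
theorem IsWeightedColimit.uncurry_hom_ext {F : EnrichedFunctor V L V} {c : V}
    {η : ∀ k : Lᵒᵖ, φ.obj k ⟶ (EnrichedCategory.Hom (F.obj k.unop) c : V)}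
    (h : IsWeightedColimit φ F c η) {X v : V} {f g : c ⊗ X ⟶ v}
    (hfg : ∀ k, MonoidalClosed.uncurry (η k) ▷ X ≫ f = MonoidalClosed.uncurry (η k) ▷ X ≫ g) :
    f = g := by
  refine MonoidalClosed.curry_injective (((isWeightedLimit_iff.1 h).2 (op v)).hom_ext fun k => ?_)
  refine (whiskerRight_eComp_op_iff _ _ _).2 ?_
  have e := (whiskerRight_eComp_op_iff (MonoidalClosed.curry g) (η k) _).1 rfl
  refine Eq.trans ?_ e
  rw [MonoidalClosed.uncurry_curry, MonoidalClosed.uncurry_curry, hfg]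

variable [HasLimits V] {A : Type u₂} [EnrichedCategory V A] [IsSmall V A]

/-- Evaluation at `a` is compatible with the composition of the opposite of `[A, V]`. -/
theorem eComp_op_natProj (a : A) (F G H : EnrichedFunctor V A V) :
    eComp V (op F) (op G) (op H) ≫ natProj H F a =
      (natProj G F a ⊗ₘ natProj H G a) ≫ eComp V (op (F.obj a)) (op (G.obj a)) (op (H.obj a)) :=
  (opFunctor V (evalFunctor a)).map_comp (op F) (op G) (op H)

theorem whiskerLeft_eComp_op_natProj (a : A) (F G H : EnrichedFunctor V A V) {Y : V}
    (s : Y ⟶ (G ⟶[V] F)) :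
    ((F ⟶[V] H) ◁ s ≫ eComp V (op H) (op F) (op G)) ≫ natProj G H a =
      natProj F H a ▷ Y ≫ (EnrichedCategory.Hom (F.obj a) (H.obj a) : V) ◁ (s ≫ natProj G F a) ≫
        eComp V (op (H.obj a)) (op (F.obj a)) (op (G.obj a)) := by
  refine (Category.assoc _ _ _).trans ((congrArg ((F ⟶[V] H) ◁ s ≫ ·)
    (eComp_op_natProj a H F G)).trans ?_)
  rw [MonoidalCategory.tensorHom_def'_assoc]
  simp only [MonoidalCategory.whiskerLeft_comp, Category.assoc]
  rw [← whisker_exchange_assoc, ← whisker_exchange_assoc]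
  rfl

/-- The naturality square of an induced family, precomposed with a coprojection: it commutes because
the coprojections are natural and both components come from the same `τ`, which takes values in
natural transformations. -/
theorem whiskerRight_act_of_whiskerRight {S H C : EnrichedFunctor V A V} {a b : A} {P X : V}
    (τ : X ⊗ P ⟶ (S ⟶[V] H)) {ηa : S.obj a ⊗ P ⟶ C.obj a} {ηb : S.obj b ⊗ P ⟶ C.obj b}
    {fa : C.obj a ⊗ X ⟶ H.obj a} {fb : C.obj b ⊗ X ⟶ H.obj b}
    (h₁ : ηa ▷ _ ≫ act C a b = swapRight _ _ _ ≫ act S a b ▷ P ≫ ηb)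
    (ha : ηa ▷ X ≫ fa = (α_ _ _ _).hom ≫ S.obj a ◁ (β_ _ _).hom ≫ S.obj a ◁ τ ≫ evalAct a S H)
    (hb : ηb ▷ X ≫ fb = (α_ _ _ _).hom ≫ S.obj b ◁ (β_ _ _).hom ≫ S.obj b ◁ τ ≫ evalAct b S H) :
    ηa ▷ (X ⊗ (a ⟶[V] b)) ≫ (α_ _ _ _).inv ≫ fa ▷ (a ⟶[V] b) ≫ act H a b =
      ηa ▷ (X ⊗ (a ⟶[V] b)) ≫ (α_ _ _ _).inv ≫ swapRight _ _ _ ≫ act C a b ▷ X ≫ fb := by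
  have h₃ := swapRight_tensor_middle (S.obj a) P X (a ⟶[V] b)
  have h₄ : (α_ (S.obj a) P X).hom ▷ (a ⟶[V] b) ≫ swapRight (S.obj a) (P ⊗ X) (a ⟶[V] b) =
      swapRight (S.obj a ⊗ P) X _ ≫ swapRight (S.obj a) P _ ▷ X ≫ (α_ _ _ _).hom := by
    rw [← cancel_mono (α_ _ _ _).inv, Category.assoc, h₃]
    simp
  rw [associator_inv_naturality_left_assoc, ← comp_whiskerRight_assoc, ha]
  simp only [comp_whiskerRight, Category.assoc]
  rw [evalAct_whiskerRight_act, reassoc_of% swapRight_naturality_middle (V := V),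
    reassoc_of% swapRight_naturality_middle (V := V), reassoc_of% h₄,
    associator_inv_naturality_left_assoc,
    reassoc_of% swapRight_naturality_left (V := V), ← comp_whiskerRight_assoc _ _ X, h₁]
  simp only [comp_whiskerRight, Category.assoc]
  rw [hb, associator_naturality_left_assoc, ← whisker_exchange_assoc, ← whisker_exchange_assoc]

/-- A pointwise colimit in a functor category is a colimit. -/
theorem isWeightedColimit_of_pointwise {S : EnrichedFunctor V L (EnrichedFunctor V A V)}
    {C : EnrichedFunctor V A V}
    (e : ∀ a (k : Lᵒᵖ), φ.obj k ⟶ (EnrichedCategory.Hom ((S.obj k.unop).obj a) (C.obj a) : V))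
    (hc : ∀ a, IsWeightedColimit φ (S.comp V (evalFunctor a)) (C.obj a) (e a))
    (hn : ∀ k, IsNatFamily V (S.obj k.unop) C fun a => e a k) :
    IsWeightedColimit φ S C fun k => natLift _ (hn k) := by
  have hproj : ∀ {X : V} (k : Lᵒᵖ) (H : EnrichedFunctor V A V) (f : X ⟶ (C ⟶[V] H)) (a : A),
      (f ▷ φ.obj k ≫ (C ⟶[V] H) ◁ natLift _ (hn k) ≫ eComp V (op H) (op C) (op (S.obj k.unop))) ≫
        natProj (S.obj k.unop) H a = (f ≫ natProj C H a) ▷ φ.obj k ≫ _ ◁ e a k ≫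
          eComp V (op (H.obj a)) (op (C.obj a)) (op ((S.obj k.unop).obj a)) := by
    intro X k H f a
    refine (Category.assoc _ _ _).trans ((congrArg (f ▷ φ.obj k ≫ ·)
      (whiskerLeft_eComp_op_natProj a C (S.obj k.unop) H (natLift _ (hn k)))).trans ?_)
    rw [natLift_natProj, comp_whiskerRight_assoc]
  have hcyl : IsCylinder (act φ) (opFunctor V S).map fun k => natLift _ (hn k) := by
    intro i j
    refine (isNatObj_natObj _ _).hom_ext fun a => ?_
    refine (Category.assoc _ _ _).trans ((congrArg (act φ i j ≫ ·)
      (natLift_natProj _ (hn j) a)).trans (((isWeightedLimit_iff.1 (hc a)).1 i j).trans ?_))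
    refine Eq.trans ?_ (Category.assoc _ _ _).symm
    refine Eq.trans ?_ (congrArg ((natLift _ (hn i) ⊗ₘ (opFunctor V S).map i j) ≫ ·)
      (eComp_op_natProj a C (S.obj i.unop) (S.obj j.unop))).symm
    refine Eq.trans ?_ (tensorHom_comp_tensorHom_assoc (natLift _ (hn i)) _ _ _ _).symm
    rw [natLift_natProj]
    rfl
  refine isWeightedLimit_iff.2 ⟨hcyl, fun ⟨H⟩ =>
    ⟨hcyl.linear (isAction_eComp (op H)), fun X τ hτ => ?_⟩⟩
  · have hlin : ∀ a, IsLinear (act φ) (fun i j => (op (H.obj a) ⟶[V] op ((S.obj i.unop).obj a)) ◁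
          (opFunctor V (S.comp V (evalFunctor a))).map i j ≫
        eComp V (op (H.obj a)) (op ((S.obj i.unop).obj a)) (op ((S.obj j.unop).obj a)))
        fun k => τ k ≫ natProj (S.obj k.unop) H a := by
      intro a
      refine IsLinear.comp hτ (θ := fun k => natProj (S.obj k.unop) H a) fun i j => ?_
      exact whiskerLeft_eComp_op_natProj a (S.obj i.unop) (S.obj j.unop) H (S.map j.unop i.unop)
    -- The universal property at each `a` separately gives the components; their naturality remains
    -- to be proved.
    obtain ⟨f, hf, hfu⟩ : ∃ f : ∀ a, X ⟶ (EnrichedCategory.Hom (C.obj a) (H.obj a) : V),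
        (∀ a k, f a ▷ φ.obj k ≫ (EnrichedCategory.Hom (C.obj a) (H.obj a) : V) ◁ e a k ≫
          eComp V (op (H.obj a)) (op (C.obj a)) (op ((S.obj k.unop).obj a)) =
            τ k ≫ natProj (S.obj k.unop) H a) ∧
        ∀ a (g : X ⟶ (EnrichedCategory.Hom (C.obj a) (H.obj a) : V)),
          (∀ k, g ▷ φ.obj k ≫ (EnrichedCategory.Hom (C.obj a) (H.obj a) : V) ◁ e a k ≫
            eComp V (op (H.obj a)) (op (C.obj a)) (op ((S.obj k.unop).obj a)) =
              τ k ≫ natProj (S.obj k.unop) H a) → g = f a := by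
      choose f hf hfu using fun a =>
        ((isWeightedLimit_iff.1 (hc a)).2 (op (H.obj a))).existsUnique X _ (hlin a)
      exact ⟨f, hf, hfu⟩
    have hf' : ∀ a k, (S.obj k.unop).obj a ◁ (β_ X (φ.obj k)).hom ≫ (α_ _ _ _).inv ≫
        MonoidalClosed.uncurry (e a k) ▷ X ≫ MonoidalClosed.uncurry (f a) =
          (S.obj k.unop).obj a ◁ τ k ≫ evalAct a (S.obj k.unop) H := by
      intro a k
      refine ((whiskerRight_eComp_op_iff (f a) (e a k) _).1 (hf a k)).trans ?_
      exact MonoidalClosed.uncurry_natural_left _ _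
    have hnat : IsNatFamily V C H f := by
      refine (isNatFamily_iff_act f).2 fun a b => ?_
      rw [← cancel_epi (α_ _ _ _).inv]
      -- The parameter object is now `X ⊗ A(a, b)`, so naturality can be tested on the
      -- coprojections.
      refine IsWeightedColimit.uncurry_hom_ext (hc a) fun k => ?_
      have h₁ := (isNatFamily_iff_act _).1 (hn k) a b
      have h₂ : ∀ a, MonoidalClosed.uncurry (e a k) ▷ X ≫ MonoidalClosed.uncurry (f a) =
          (α_ _ _ _).hom ≫ (S.obj k.unop).obj a ◁ (β_ _ _).hom ≫
            (S.obj k.unop).obj a ◁ τ k ≫ evalAct a (S.obj k.unop) H := by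
        intro a
        rw [← hf' a k, ← MonoidalCategory.whiskerLeft_comp_assoc, SymmetricCategory.symmetry]
        simp
      exact whiskerRight_act_of_whiskerRight (τ k) h₁ (h₂ a) (h₂ b)
    refine ⟨natLift f hnat, fun k => ?_, fun g hg => ?_⟩
    · refine (isNatObj_natObj _ _).hom_ext fun a => ?_
      refine (hproj k H _ a).trans ?_
      rw [natLift_natProj]
      exact hf a k
    · refine (isNatObj_natObj _ _).hom_ext fun a => ?_
      rw [natLift_natProj]
      refine hfu a _ fun k => ?_
      refine (hproj k H g a).symm.trans ?_
      rw [← hg k]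
      rfl

end PointwiseColimits

/-! ### Isomorphisms, reflections and comparison arrows -/

section Comparison

variable {V : Type v} [Category.{u} V] [MonoidalCategory V]
variable {A : Type u₁} [EnrichedCategory V A]

theorem eId_precomp {a b : A} (r : 𝟙_ V ⟶ (a ⟶[V] b)) : eId V b ≫ precomp V r b = r := by
  dsimp only [precomp]
  rw [leftUnitor_inv_naturality_assoc, whisker_exchange_assoc,
    unitors_inv_equal, ← rightUnitor_inv_naturality_assoc, e_comp_id, Category.comp_id]

theorem eId_postcomp {a b : A} (r : 𝟙_ V ⟶ (a ⟶[V] b)) : eId V a ≫ postcomp V a r = r := by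
  dsimp only [postcomp]
  rw [rightUnitor_inv_naturality_assoc, ← whisker_exchange_assoc,
    ← unitors_inv_equal, ← leftUnitor_inv_naturality_assoc, e_id_comp, Category.comp_id]

theorem precomp_eId (a b : A) : precomp V (eId V a) b = 𝟙 _ :=
  e_id_comp V a b

theorem precomp_comp {a b c : A} (r : 𝟙_ V ⟶ (a ⟶[V] b)) (s : 𝟙_ V ⟶ (b ⟶[V] c)) (d : A) :
    precomp V (s ≫ precomp V r c) d = precomp V s d ≫ precomp V r d := by
  have h := eComp_precomp r c d
  dsimp only [precomp] at h ⊢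
  simp only [comp_whiskerRight, Category.assoc] at h ⊢
  rw [← h]

/-- Yoneda, tested at two objects only: surjectivity at `a` provides the inverse, and injectivity at
`b` the second identity. -/
theorem objIso_of_isIso_precomp {a b : A} (r : 𝟙_ V ⟶ (a ⟶[V] b)) (ha : IsIso (precomp V r a))
    (hb : IsIso (precomp V r b)) : ObjIso V a b := by
  let s : 𝟙_ V ⟶ (b ⟶[V] a) := eId V a ≫ inv (precomp V r a)
  have hs : s ≫ precomp V r a = eId V a := by simp [s]
  have hs' : r ≫ precomp V s b = eId V b := by
    rw [← cancel_mono (precomp V r b), Category.assoc, ← precomp_comp, hs, precomp_eId,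
      Category.comp_id, eId_precomp]
  have key : ∀ {x y z : A} (f : 𝟙_ V ⟶ (x ⟶[V] y)) (g : 𝟙_ V ⟶ (y ⟶[V] z)),
      ForgetEnrichment.homOf V f ≫ ForgetEnrichment.homOf V g =
        ForgetEnrichment.homOf V (g ≫ precomp V f z) := by
    intro x y z f g
    refine (ForgetEnrichment.homOf_comp V f g).symm.trans (congrArg (ForgetEnrichment.homOf V) ?_)
    dsimp only [precomp]
    rw [leftUnitor_inv_naturality_assoc, whisker_exchange_assoc,
      MonoidalCategory.tensorHom_def_assoc]
  refine ⟨⟨ForgetEnrichment.homOf V r, ForgetEnrichment.homOf V s, ?_, ?_⟩⟩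
  · rw [key, hs, ForgetEnrichment.homOf_eId]
  · rw [key, hs', ForgetEnrichment.homOf_eId]

theorem ObjIso.exists_isIso {a b : A} (h : ObjIso V a b) : ∃ r : 𝟙_ V ⟶ (a ⟶[V] b),
    (∀ c, IsIso (precomp V r c)) ∧ ∀ c, IsIso (postcomp V c r) := by
  obtain ⟨e⟩ := h
  exact ⟨ForgetEnrichment.homTo V e.hom,
    fun c => ⟨_, precomp_inv_hom e.symm c, precomp_inv_hom e c⟩,
    fun c => ⟨_, postcomp_hom_inv e c, postcomp_hom_inv e.symm c⟩⟩

theorem ObjIso.symm {a b : A} (h : ObjIso V a b) : ObjIso V b a :=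
  ⟨h.some.symm⟩

theorem IsReflection.of_objIso {P : A → Prop} {x y d : A} {r : 𝟙_ V ⟶ (x ⟶[V] d)}
    (h : IsReflection P x d r) (e : ObjIso V x y) :
    ∃ r' : 𝟙_ V ⟶ (y ⟶[V] d), IsReflection P y d r' := by
  obtain ⟨s, hs, -⟩ := e.symm.exists_isIso
  refine ⟨r ≫ precomp V s d, h.mem, fun c hc => ?_⟩
  have := h.isIso c hc
  have := hs c
  rw [precomp_comp]
  infer_instance

/-- Reflections are unique up to isomorphism. -/
theorem IsReflection.objIso {P : A → Prop} {x d d' : A} {r : 𝟙_ V ⟶ (x ⟶[V] d)}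
    {r' : 𝟙_ V ⟶ (x ⟶[V] d')} (h : IsReflection P x d r) (h' : IsReflection P x d' r') :
    ObjIso V d d' := by
  have := h.isIso d' h'.mem
  -- The factorisation of `r'` through `r`. It is orthogonal to all of `P` by cancellation, and `d`
  -- and `d'` both lie in `P`.
  let s : 𝟙_ V ⟶ (d ⟶[V] d') := r' ≫ inv (precomp V r d')
  have hs : s ≫ precomp V r d' = r' := by simp [s]
  have key : ∀ c, P c → IsIso (precomp V s c) := by
    intro c hc
    have h₁ := h.isIso c hc
    have h₂ := h'.isIso c hc
    rw [← hs, precomp_comp] at h₂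
    exact IsIso.of_isIso_comp_right _ (precomp V r c)
  exact objIso_of_isIso_precomp s (key d h.mem) (key d' h'.mem)

section Limits

variable {J : Type u₂} [EnrichedCategory V J] {P : J → V} {p : ∀ i j, P i ⊗ (i ⟶[V] j) ⟶ P j}
  {T T' : J → A} {t : ∀ i j : J, (i ⟶[V] j) ⟶ (T i ⟶[V] T j)}
  {t' : ∀ i j : J, (i ⟶[V] j) ⟶ (T' i ⟶[V] T' j)} {l l' : A} {μ : ∀ j, P j ⟶ (l ⟶[V] T j)}
  {μ' : ∀ j, P j ⟶ (l' ⟶[V] T' j)} {ρ : ∀ j, 𝟙_ V ⟶ (T' j ⟶[V] T j)}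

theorem PreservesCylinder.exists_precomp {σ : ∀ j, P j ⟶ (l' ⟶[V] T j)}
    (h : PreservesCylinder (eComp V l') p t μ) (hσ : IsCylinder p t σ) :
    ∃ r : 𝟙_ V ⟶ (l' ⟶[V] l), ∀ j, μ j ≫ precomp V r (T j) = σ j := by
  obtain ⟨r, hr, -⟩ := h.existsUnique _ _
    ((hσ.linear (isAction_eComp l')).whiskerRight (eId V l'))
  refine ⟨r, fun j => ?_⟩
  have h := (λ_ _).inv ≫= hr j
  rw [← whisker_exchange_assoc, ← whisker_exchange_assoc, ← leftUnitor_inv_naturality_assoc,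
    ← leftUnitor_inv_naturality_assoc, e_id_comp, Category.comp_id] at h
  exact h

theorem IsCylinder.postcomp (hμ' : IsCylinder p t' μ')
    (hρ : ∀ i j, t' i j ≫ postcomp V (T' i) (ρ j) = t i j ≫ precomp V (ρ i) (T j)) :
    IsCylinder p t fun j => μ' j ≫ EnrichedFlat.postcomp V l' (ρ j) := by
  intro i j
  rw [reassoc_of% hμ' i j, eComp_postcomp, MonoidalCategory.tensorHom_def_assoc,
    ← MonoidalCategory.whiskerLeft_comp_assoc, hρ, MonoidalCategory.whiskerLeft_comp_assoc,
    ← postcomp_eComp, whisker_exchange_assoc, MonoidalCategory.tensorHom_def_assoc,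
    comp_whiskerRight_assoc]

/-- The comparison of limits which is induced by a family of arrows between the diagrams. -/
theorem PreservesCylinder.exists_isIso_postcomp (hμ : ∀ a, PreservesCylinder (eComp V a) p t μ)
    (hμ' : IsCylinder p t' μ')
    (hρ : ∀ i j, t' i j ≫ postcomp V (T' i) (ρ j) = t i j ≫ precomp V (ρ i) (T j)) :
    ∃ r : 𝟙_ V ⟶ (l' ⟶[V] l), ∀ a, (∀ j, IsIso (postcomp V a (ρ j))) →
      PreservesCylinder (eComp V a) p t' μ' → IsIso (postcomp V a r) := by
  obtain ⟨r, hr⟩ := (hμ l').exists_precomp (hμ'.postcomp hρ)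
  refine ⟨r, fun a hi ha => IsUniversal.isIso ha (hμ a)
    (θ := fun j => postcomp V a (ρ j)) (fun i j => ?_) _ fun j => ?_⟩
  · rw [Category.assoc, eComp_postcomp, ← MonoidalCategory.whiskerLeft_comp_assoc, hρ,
      MonoidalCategory.whiskerLeft_comp_assoc, ← postcomp_eComp, whisker_exchange_assoc]
  · rw [← whisker_exchange_assoc, postcomp_eComp, ← MonoidalCategory.whiskerLeft_comp_assoc, hr,
      Category.assoc, eComp_postcomp, MonoidalCategory.whiskerLeft_comp_assoc]

end Limits

section Reflect

variable {B : Type u₂} [EnrichedCategory V B] {K : Type u₃} [EnrichedCategory V K]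

/-- The only possible action on homs: send an arrow to its composite with the unit of the target,
factor this through the unit of the source, and lift along the fully faithful `y`. -/
theorem reflect_aux {y : EnrichedFunctor V B A} (S : EnrichedFunctor V K A) {d : K → B}
    (r : ∀ k, 𝟙_ V ⟶ (S.obj k ⟶[V] y.obj (d k))) (hy : ∀ a b, IsIso (y.map a b))
    (hr : ∀ k k', IsIso (precomp V (r k) (y.obj (d k')))) :
    ∃ R : ∀ i j : K, (i ⟶[V] j) ⟶ (d i ⟶[V] d j), ∀ i j,
      R i j ≫ y.map (d i) (d j) ≫ precomp V (r i) (y.obj (d j)) =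
        S.map i j ≫ postcomp V (S.obj i) (r j) :=
  ⟨fun i j => S.map i j ≫ postcomp V (S.obj i) (r j) ≫ inv (precomp V (r i) (y.obj (d j))) ≫
    inv (y.map (d i) (d j)), fun i j => by simp⟩

/-- If `y` is fully faithful, then arrows `S k ⟶ y (d k)` with the universal property of
reflections into the image of `y` make `d` into a functor. -/
theorem exists_reflect {y : EnrichedFunctor V B A} (S : EnrichedFunctor V K A) {d : K → B}
    (r : ∀ k, 𝟙_ V ⟶ (S.obj k ⟶[V] y.obj (d k))) (hy : ∀ a b, IsIso (y.map a b))
    (hr : ∀ k k', IsIso (precomp V (r k) (y.obj (d k')))) :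
    ∃ R : ∀ i j : K, (i ⟶[V] j) ⟶ (d i ⟶[V] d j),
      (∀ i, eId V i ≫ R i i = eId V (d i)) ∧
      (∀ i j k, eComp V i j k ≫ R i k = (R i j ⊗ₘ R j k) ≫ eComp V (d i) (d j) (d k)) ∧
      ∀ i j, R i j ≫ y.map (d i) (d j) ≫ precomp V (r i) (y.obj (d j)) =
        S.map i j ≫ postcomp V (S.obj i) (r j) := by
  obtain ⟨R, hR⟩ := reflect_aux S r hy hr
  refine ⟨R, fun i => ?_, fun i j k => ?_, hR⟩
  -- Applying `y` and precomposing with the unit is monic, so functoriality of `R` reduces to that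
  -- of `S`.
  · rw [← cancel_mono (y.map (d i) (d i) ≫ precomp V (r i) (y.obj (d i))), Category.assoc, hR,
      ← Category.assoc, S.map_id, ← Category.assoc, y.map_id, eId_precomp, eId_postcomp]
  · rw [← cancel_mono (y.map (d i) (d k) ≫ precomp V (r i) (y.obj (d k))), Category.assoc, hR,
      ← Category.assoc, S.map_comp, Category.assoc, eComp_postcomp, Category.assoc,
      reassoc_of% y.map_comp, eComp_precomp, MonoidalCategory.tensorHom_def_assoc,
      ← MonoidalCategory.whiskerLeft_comp_assoc, ← hR, ← Category.assoc (R j k),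
      MonoidalCategory.whiskerLeft_comp_assoc, ← postcomp_eComp, whisker_exchange_assoc,
      ← comp_whiskerRight_assoc, ← hR, ← whisker_exchange_assoc,
      MonoidalCategory.tensorHom_def_assoc, MonoidalCategory.tensorHom_def_assoc]
    simp only [MonoidalCategory.whiskerLeft_comp, comp_whiskerRight, Category.assoc]
    simp only [whisker_exchange_assoc]

end Reflect

end Comparison

theorem PreservesCylinder.of_isModuleHom_inv {V : Type v} [Category.{u} V] [MonoidalCategory V]
    {J : Type u₁} [EnrichedCategory V J] {A : Type u₂} [EnrichedCategory V A] {P : J → V}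
    {p : ∀ i j, P i ⊗ (i ⟶[V] j) ⟶ P j} {T : J → A} {t : ∀ i j : J, (i ⟶[V] j) ⟶ (T i ⟶[V] T j)}
    {l : A} {μ : ∀ j, P j ⟶ (l ⟶[V] T j)} {F F' : A → V} {f : ∀ a b, F a ⊗ (a ⟶[V] b) ⟶ F b}
    {f' : ∀ a b, F' a ⊗ (a ⟶[V] b) ⟶ F' b} (h : PreservesCylinder f p t μ) {θ : ∀ a, F' a ⟶ F a}
    (hθ : IsModuleHom f' f θ) (hi : ∀ a, IsIso (θ a)) : PreservesCylinder f' p t μ :=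
  h.of_isModuleHom hθ.inv fun _ => inferInstance

/-! ### Composition in the opposite category -/

section Colimits

variable {V : Type v} [Category.{u} V] [MonoidalCategory V] [SymmetricCategory V]
variable {A : Type u₁} [EnrichedCategory V A] {B : Type u₂} [EnrichedCategory V B]

theorem postcomp_op {a b : A} (r : 𝟙_ V ⟶ (a ⟶[V] b)) (c : A) :
    postcomp V (A := Aᵒᵖ) (op c) (b := op b) (c := op a) r = precomp V r c := by
  have h : (ρ_ (b ⟶[V] c)).inv ≫ (b ⟶[V] c) ◁ r ≫ (β_ _ _).hom ≫ eComp V a b c =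
      precomp V r c := by
    rw [braiding_naturality_right_assoc]
    simp [precomp]
  refine Eq.trans ?_ h
  dsimp only [postcomp]
  rw [eComp_op_eq]
  rfl

theorem precomp_op {a b : A} (r : 𝟙_ V ⟶ (a ⟶[V] b)) (c : A) :
    precomp V (A := Aᵒᵖ) (a := op b) (b := op a) r (op c) = postcomp V c r := by
  have h : (λ_ (c ⟶[V] a)).inv ≫ r ▷ (c ⟶[V] a) ≫ (β_ _ _).hom ≫ eComp V c a b =
      postcomp V c r := by
    rw [braiding_naturality_left_assoc]
    simp [postcomp]
  refine Eq.trans ?_ h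
  dsimp only [precomp]
  rw [eComp_op_eq]
  rfl

end Colimits

/-! ### The Yoneda embedding -/

section Yoneda

variable {V : Type v} [Category.{u} V] [MonoidalCategory V] [SymmetricCategory V]
  [MonoidalClosed V] [HasLimits V]
variable {N : Type u₁} [EnrichedCategory V N] [IsSmall V N]

omit [HasLimits V] [IsSmall V N] in
theorem isNatFamily_homFunctor_map (n n' : N) :
    IsNatFamily V (representable n) (representable n')
      fun x : Nᵒᵖ => (homFunctor x.unop).map n n' := by
  refine (isNatFamily_iff_act (F := representable n) (G := representable n')
    (fun x => (homFunctor x.unop).map n n')).2 fun a b => ?_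
  have h : act (representable n) a b = (β_ _ _).hom ≫ eComp V b.unop a.unop n :=
    act_homFunctor _ _ _
  have h' : act (representable n') a b = (β_ _ _).hom ≫ eComp V b.unop a.unop n' :=
    act_homFunctor _ _ _
  rw [h, h']
  change act (homFunctor a.unop) n n' ▷ (b.unop ⟶[V] a.unop) ≫ (β_ _ _).hom ≫
      eComp V b.unop a.unop n' =
    swapRight (a.unop ⟶[V] n) (n ⟶[V] n') (b.unop ⟶[V] a.unop) ≫
      ((β_ _ _).hom ≫ eComp V b.unop a.unop n) ▷ (n ⟶[V] n') ≫ act (homFunctor b.unop) n n'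
  rw [act_homFunctor, act_homFunctor]
  change eComp V a.unop n n' ▷ (b.unop ⟶[V] a.unop) ≫ (β_ _ _).hom ≫ eComp V b.unop a.unop n' =
    swapRight (a.unop ⟶[V] n) (n ⟶[V] n') (b.unop ⟶[V] a.unop) ≫
      ((β_ _ _).hom ≫ eComp V b.unop a.unop n) ▷ (n ⟶[V] n') ≫ eComp V b.unop n n'
  rw [braiding_naturality_left_assoc, comp_whiskerRight_assoc, ← e_assoc']
  simp [swapRight, braiding_tensor_left_hom]

/-- The Yoneda embedding `N ⟶ [Nᵒᵖ, V]`. -/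
def yonedaFunctor : EnrichedFunctor V N (EnrichedFunctor V Nᵒᵖ V) where
  obj n := representable n
  map n n' := natLift _ (isNatFamily_homFunctor_map n n')
  map_id a := by
    refine (isNatObj_natObj _ _).hom_ext fun x => (Category.assoc _ _ _).trans ?_
    refine (congrArg (eId V a ≫ ·)
      (natLift_natProj _ (isNatFamily_homFunctor_map a a) x)).trans ?_
    exact ((homFunctor x.unop).map_id a).trans
      ((evalFunctor x).map_id (representable a : EnrichedFunctor V Nᵒᵖ V)).symm
  map_comp a b c := by
    refine (isNatObj_natObj _ _).hom_ext fun x => (Category.assoc _ _ _).trans ?_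
    refine (congrArg (eComp V a b c ≫ ·)
      (natLift_natProj _ (isNatFamily_homFunctor_map a c) x)).trans ?_
    refine ((homFunctor x.unop).map_comp a b c).trans (Eq.trans ?_ (Category.assoc _ _ _).symm)
    have h := (evalFunctor x).map_comp (representable a : EnrichedFunctor V Nᵒᵖ V)
      (representable b) (representable c)
    refine Eq.trans ?_ (congrArg ((natLift _ (isNatFamily_homFunctor_map a b) ⊗ₘ
      natLift _ (isNatFamily_homFunctor_map b c)) ≫ ·) h).symm
    refine Eq.trans ?_ (Category.assoc _ _ _)
    refine congrArg (· ≫ eComp V (x.unop ⟶[V] a) (x.unop ⟶[V] b) (x.unop ⟶[V] c)) ?_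
    refine Eq.trans ?_ (tensorHom_comp_tensorHom (natLift _ (isNatFamily_homFunctor_map a b))
      (natLift _ (isNatFamily_homFunctor_map b c)) (natProj _ _ x) (natProj _ _ x)).symm
    exact congrArg₂ (· ⊗ₘ ·) (natLift_natProj _ (isNatFamily_homFunctor_map a b) x).symm
      (natLift_natProj _ (isNatFamily_homFunctor_map b c) x).symm

/-- The evaluation `[Nᵒᵖ, V](N(-, n), H) ⟶ H n` at the identity. -/
def yonedaEval (n : N) (H : EnrichedFunctor V Nᵒᵖ V) :
    (yonedaFunctor.obj n ⟶[V] H) ⟶ H.obj (op n) :=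
  evalId (op n) H

instance isIso_yonedaEval (n : N) (H : EnrichedFunctor V Nᵒᵖ V) : IsIso (yonedaEval n H) :=
  isIso_evalId _ _

theorem whiskerLeft_yonedaFunctor_map (n n' : N) (x : Nᵒᵖ) :
    (x.unop ⟶[V] n) ◁ yonedaFunctor.map n n' ≫
      evalAct x (yonedaFunctor.obj n) (yonedaFunctor.obj n') = eComp V x.unop n n' :=
  (whiskerLeft_natLift_evalAct _ (isNatFamily_homFunctor_map n n') x).trans
    (act_homFunctor x.unop n n')

theorem yonedaFunctor_map_yonedaEval (n n' : N) :
    yonedaFunctor.map n n' ≫ yonedaEval n (yonedaFunctor.obj n') = 𝟙 (n ⟶[V] n') := by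
  have h := whiskerLeft_yonedaFunctor_map (V := V) n n' (op n)
  have e : ∀ {X Y P Z : V} (f : X ⟶ Y) (i : 𝟙_ V ⟶ P) (g : P ⊗ Y ⟶ Z),
      f ≫ (λ_ Y).inv ≫ i ▷ Y ≫ g = (λ_ X).inv ≫ i ▷ X ≫ P ◁ f ≫ g := by
    intro X Y P Z f i g
    rw [leftUnitor_inv_naturality_assoc, whisker_exchange_assoc]
  refine (e (yonedaFunctor.map n n') (eId V n) (evalAct (op n) (yonedaFunctor.obj n)
    (yonedaFunctor.obj n'))).trans ?_
  exact (congrArg (fun k => (λ_ (n ⟶[V] n')).inv ≫ eId V n ▷ (n ⟶[V] n') ≫ k) h).trans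
    (e_id_comp V n n')

/-- Full faithfulness: evaluation at the identity is invertible, and the action of the embedding on
homs is a section of it. -/
theorem isIso_yonedaFunctor_map (n n' : N) :
    IsIso (yonedaFunctor.map (V := V) n n') := by
  have h := yonedaFunctor_map_yonedaEval (V := V) n n'
  have h₁ := isIso_yonedaEval n (yonedaFunctor.obj n' : EnrichedFunctor V Nᵒᵖ V)
  have h₂ : IsIso (𝟙 (n ⟶[V] n')) := inferInstance
  exact @IsIso.of_isIso_fac_right _ _ _ _ _ _ _ _ h₁ h₂ h

theorem whiskerRight_eComp_yonedaEval (a b : N) (H : EnrichedFunctor V Nᵒᵖ V) :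
    yonedaFunctor.map b a ▷ (yonedaFunctor.obj a ⟶[V] H) ≫
        eComp V (yonedaFunctor.obj b) (yonedaFunctor.obj a) H ≫ yonedaEval b H =
      homEvalAct (op a) (op b) H := by
  have h : eComp V (yonedaFunctor.obj b) (yonedaFunctor.obj a) H ≫ yonedaEval b H =
      yonedaEval b (yonedaFunctor.obj a) ▷ _ ≫ homEvalAct (op a) (op b) H :=
    isModuleHom_evalId (op b) (yonedaFunctor.obj a) H
  rw [h]
  refine (comp_whiskerRight_assoc _ _ _ _).symm.trans ?_
  refine (congrArg (· ▷ _ ≫ homEvalAct (op a) (op b) H)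
    (yonedaFunctor_map_yonedaEval b a)).trans ?_
  exact (congrArg (· ≫ homEvalAct (op a) (op b) H) (id_whiskerRight _ _)).trans
    (Category.id_comp _)

/-- The functor `[Nᵒᵖ, V](N(-, n), H)` of `n` is isomorphic to `H`. -/
theorem isModuleHom_yonedaEval (H : EnrichedFunctor V Nᵒᵖ V) :
    IsModuleHom (J := Nᵒᵖ) (Q := fun n => (op H ⟶[V] (opFunctor V yonedaFunctor).obj n))
      (fun a b => (op H ⟶[V] (opFunctor V yonedaFunctor).obj a) ◁
        (opFunctor V yonedaFunctor).map a b ≫ eComp V (op H) _ _)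
      (act H) fun n => yonedaEval n.unop H := by
  rintro ⟨a⟩ ⟨b⟩
  have h : (yonedaFunctor.obj a ⟶[V] H) ◁ yonedaFunctor.map b a ≫ (β_ _ _).hom ≫
      eComp V (yonedaFunctor.obj b) (yonedaFunctor.obj a) H ≫ yonedaEval b H =
      (β_ _ _).hom ≫ homEvalAct (op a) (op b) H := by
    rw [braiding_naturality_right_assoc]
    exact congrArg (_ ≫ ·) (whiskerRight_eComp_yonedaEval a b H)
  refine Eq.trans ?_ (h.trans (evalId_whiskerRight_act (op a) H (op b)).symm)
  have e := eComp_op_eq V (op (yonedaFunctor.obj b)) (op (yonedaFunctor.obj a)) (op H)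
  refine (Category.assoc _ _ _).trans ((congrArg
    ((yonedaFunctor.obj a ⟶[V] H) ◁ yonedaFunctor.map b a ≫ · ≫ yonedaEval b H) e).trans ?_)
  exact (congrArg ((yonedaFunctor.obj a ⟶[V] H) ◁ yonedaFunctor.map b a ≫ ·) (Category.assoc _ _ _))

/-- Since `[N(-, n), H]` is `H n`, a presheaf `H` that sends a colimit of `N` to a limit sees the
representable at the colimit as a colimit of representables, even though the Yoneda embedding need
not preserve that colimit. -/
theorem preservesCylinder_yonedaFunctor {J : Type u₂} [EnrichedCategory V J] {P : J → V}
    {p : ∀ i j : J, P i ⊗ (i ⟶[V] j) ⟶ P j} {T : J → Nᵒᵖ}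
    {t : ∀ i j : J, (i ⟶[V] j) ⟶ (T i ⟶[V] T j)} {l : Nᵒᵖ} {ν : ∀ i, P i ⟶ (l ⟶[V] T i)}
    {H : EnrichedFunctor V Nᵒᵖ V} (h : PreservesCylinder (act H) p t ν) :
    PreservesCylinder (T := fun j => (opFunctor V yonedaFunctor).obj (T j)) (eComp V (op H)) p
      (fun i j => t i j ≫ (opFunctor V yonedaFunctor).map _ _)
      (fun j => ν j ≫ (opFunctor V yonedaFunctor).map l (T j)) := by
  rw [← preservesCylinder_comp (opFunctor V yonedaFunctor)]
  exact h.of_isModuleHom_inv (isModuleHom_yonedaEval H) fun n => isIso_yonedaEval n.unop H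

end Yoneda

/-! ### Comparison arrows out of a colimit -/

section ColimitComparison

variable {V : Type v} [Category.{u} V] [MonoidalCategory V] [SymmetricCategory V]
  [MonoidalClosed V]
variable {A : Type u₁} [EnrichedCategory V A] {K : Type u₂} [EnrichedCategory V K]
  {φ : EnrichedFunctor V Kᵒᵖ V} {S R : EnrichedFunctor V K A} {c d : A}
  {η : ∀ k : Kᵒᵖ, φ.obj k ⟶ (S.obj k.unop ⟶[V] c)}
  {η' : ∀ k : Kᵒᵖ, φ.obj k ⟶ (R.obj k.unop ⟶[V] d)}

/-- If every `S k ⟶ R k` is orthogonal to `H`, and if `H` sees `d` as a colimit of `R`, then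
the comparison from the colimit of `S` to `d` is orthogonal to `H`. -/
theorem IsWeightedColimit.exists_isIso_precomp (hc : IsWeightedColimit φ S c η)
    (ρ : ∀ k, 𝟙_ V ⟶ (S.obj k ⟶[V] R.obj k))
    (hρ : ∀ i j, R.map i j ≫ precomp V (ρ i) (R.obj j) = S.map i j ≫ postcomp V (S.obj i) (ρ j))
    (hη' : IsCylinder (l := op d) (act φ) (opFunctor V R).map η') :
    ∃ r : 𝟙_ V ⟶ (c ⟶[V] d), ∀ H, (∀ k, IsIso (precomp V (ρ k) H)) →
      PreservesCylinder (eComp V (op H)) (act φ) (opFunctor V R).map η' →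
        IsIso (precomp V r H) := by
  have hρ' : ∀ i j : Kᵒᵖ, (opFunctor V R).map i j ≫
      postcomp V (A := Aᵒᵖ) (op (R.obj i.unop)) (b := op (R.obj j.unop)) (c := op (S.obj j.unop))
        (ρ j.unop) = (opFunctor V S).map i j ≫
      precomp V (A := Aᵒᵖ) (a := op (R.obj i.unop)) (b := op (S.obj i.unop)) (ρ i.unop)
        (op (S.obj j.unop)) := by
    intro i j
    rw [postcomp_op, precomp_op]
    exact hρ j.unop i.unop
  -- In `Aᵒᵖ` the `ρ k` point from the diagram of `R` to that of `S`, and `c` is a limit of the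
  -- latter. The comparison of limits applies.
  obtain ⟨r, hr⟩ := PreservesCylinder.exists_isIso_postcomp (A := Aᵒᵖ)
    (T := (opFunctor V S).obj) (T' := (opFunctor V R).obj) (isWeightedLimit_iff.1 hc).2 hη'
    (ρ := fun k : Kᵒᵖ => ρ k.unop) hρ'
  refine ⟨r, fun H hi h => ?_⟩
  rw [← postcomp_op]
  exact hr (op H) (fun k => (postcomp_op (ρ k.unop) H).symm ▸ hi k.unop) h

theorem postcomp_eId {V : Type v} [Category.{u} V] [MonoidalCategory V] {A : Type u₁}
    [EnrichedCategory V A] (a b : A) : postcomp V a (eId V b) = 𝟙 _ :=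
  e_comp_id V a b

/-- Colimits are unique up to isomorphism. -/
theorem IsWeightedColimit.objIso {η' : ∀ k : Kᵒᵖ, φ.obj k ⟶ (S.obj k.unop ⟶[V] d)}
    (hc : IsWeightedColimit φ S c η) (hd : IsWeightedColimit φ S d η') : ObjIso V c d := by
  obtain ⟨hd₁, hd₂⟩ := isWeightedLimit_iff.1 hd
  obtain ⟨r, hr⟩ := hc.exists_isIso_precomp (fun k => eId V (S.obj k))
    (fun i j => by rw [precomp_eId, postcomp_eId]) hd₁
  have h : ∀ H, IsIso (precomp V r H) := fun H => hr H
    (fun k => by rw [precomp_eId]; infer_instance) (hd₂ (op H))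
  exact objIso_of_isIso_precomp r (h c) (h d)

end ColimitComparison

/-! ### Closure properties of continuous functors -/

section Continuous

variable {V : Type v} [Category.{u} V] [MonoidalCategory V] [SymmetricCategory V]
  [MonoidalClosed V] {Φ : WeightClass.{u, v, w} V} {A : Type u₁} [EnrichedCategory V A]

theorem isContinuous_iff {F : EnrichedFunctor V A V} : IsContinuous Φ F ↔
    ∀ (K : Type w) [EnrichedCategory V K] [IsSmall V K] (φ : EnrichedFunctor V Kᵒᵖ V), Φ K φ →
      ∀ (T : EnrichedFunctor V Kᵒᵖ A) (l : A) (μ : ∀ k : Kᵒᵖ, φ.obj k ⟶ (l ⟶[V] T.obj k)),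
        IsWeightedLimit φ T l μ → PreservesCylinder (act F) (act φ) T.map μ := by
  have key : ∀ (K : Type w) [EnrichedCategory V K] (φ : EnrichedFunctor V Kᵒᵖ V)
      (T : EnrichedFunctor V Kᵒᵖ A) (l : A) (μ : ∀ k : Kᵒᵖ, φ.obj k ⟶ (l ⟶[V] T.obj k)),
      IsWeightedLimit φ T l μ →
        (IsWeightedLimit φ (T.comp V F) (F.obj l) (fun k => μ k ≫ F.map l (T.obj k)) ↔
          PreservesCylinder (act F) (act φ) T.map μ) :=
    fun K _ φ T l μ h => isWeightedLimit_comp_iff (isWeightedLimit_iff.1 h).1 F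
  constructor
  · intro h K _ _ φ hφ T l μ hμ
    exact (key K φ T l μ hμ).1 (h K φ hφ T l μ hμ)
  · intro h K _ _ φ hφ T l μ hμ
    exact (key K φ T l μ hμ).2 (h K φ hφ T l μ hμ)

/-- Preservation by all hom-functors is what defines a weighted limit. -/
theorem isContinuous_homFunctor (a : A) : IsContinuous Φ (homFunctor (V := V) a) := by
  rw [isContinuous_iff]
  intro K _ _ φ _ T l μ hμ
  have e : act (homFunctor a) = eComp V a := funext fun b => funext fun c => act_homFunctor a b c
  rw [e]
  exact (isWeightedLimit_iff.1 hμ).2 a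

variable [HasLimits V] [IsSmall V A]

/-- The component at `a` of a transformation. -/
def component {F G : EnrichedFunctor V A V} (r : 𝟙_ V ⟶ (F ⟶[V] G)) (a : A) : F.obj a ⟶ G.obj a :=
  (ρ_ _).inv ≫ F.obj a ◁ r ≫ evalAct a F G

theorem isModuleHom_component {F G : EnrichedFunctor V A V} (r : 𝟙_ V ⟶ (F ⟶[V] G)) :
    IsModuleHom (act F) (act G) (component r) := by
  intro a b
  dsimp only [component]
  simp only [comp_whiskerRight, Category.assoc]
  rw [evalAct_whiskerRight_act, reassoc_of% swapRight_naturality_middle (V := V),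
    rightUnitor_inv_naturality_assoc, whisker_exchange_assoc]
  simp [swapRight, braiding_tensorUnit_left]

theorem evalId_component {F G : EnrichedFunctor V A V} (r : 𝟙_ V ⟶ (F ⟶[V] G)) (a : A) :
    evalId a F ≫ component r a = postcomp V (homFunctor a) r ≫ evalId a G := by
  dsimp only [component, postcomp]
  simp only [Category.assoc]
  rw [isModuleHom_evalId a F G, rightUnitor_inv_naturality_assoc, whisker_exchange_assoc]

theorem isIso_component {F G : EnrichedFunctor V A V} {r : 𝟙_ V ⟶ (F ⟶[V] G)} {a : A}
    (h : IsIso (postcomp V (homFunctor a : EnrichedFunctor V A V) r)) :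
    IsIso (component r a) := by
  have e : IsIso (evalId a F ≫ component r a) := by
    rw [evalId_component]
    infer_instance
  exact IsIso.of_isIso_comp_left (evalId a F) _

theorem IsContinuous.of_objIso {F G : EnrichedFunctor V A V} (hF : IsContinuous Φ F)
    (e : ObjIso V F G) : IsContinuous Φ G := by
  obtain ⟨r, -, hr⟩ := e.exists_isIso
  rw [isContinuous_iff] at hF ⊢
  intro K _ _ φ hφ T l μ hμ
  exact (hF K φ hφ T l μ hμ).of_isModuleHom (isModuleHom_component r)
    fun a => isIso_component (hr (homFunctor a))

/-- Continuous functors are closed under limits. -/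
theorem closedUnderLimits_isContinuous (Ψ : WeightClass.{u, v, w} V) :
    ClosedUnderLimits Ψ fun F : EnrichedFunctor V A V => IsContinuous Φ F := by
  intro K _ _ φ _ T F μ hT hF
  rw [isContinuous_iff]
  intro K' _ _ ψ hψ S l ν hν
  exact PreservesCylinder.of_isWeightedLimit hF (isWeightedLimit_iff.1 hν).1
    fun j => isContinuous_iff.1 (hT j) K' ψ hψ S l ν hν

/-- The crux of closure under flat colimits. The transpose sends a `Φ`-limit of `A` to a limit in
`[L, V]` because each `S k` preserves it, and `W` preserves the latter. -/
theorem IsContinuous.transpose_comp {L : Type w} [EnrichedCategory V L] [IsSmall V L]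
    {W : EnrichedFunctor V (EnrichedFunctor V L V) V} (hW : IsContinuous Φ W)
    {S : EnrichedFunctor V L (EnrichedFunctor V A V)} (hS : ∀ k, IsContinuous Φ (S.obj k)) :
    IsContinuous Φ ((transpose S).comp V W) := by
  rw [isContinuous_iff] at hW ⊢
  intro K _ _ φ hφ T l μ hμ
  have hμ' := (isWeightedLimit_iff.1 hμ).1
  have h := hW K φ hφ _ _ _ (isWeightedLimit_transpose hμ'
    fun x => isContinuous_iff.1 (hS x) K φ hφ T l μ hμ)
  have e : act ((transpose S).comp V W) = fun a b =>
      W.obj ((transpose S).obj a) ◁ (transpose S).map a b ≫ act W _ _ :=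
    funext fun a => funext fun b => act_comp _ _ a b
  rw [e]
  exact (preservesCylinder_comp (transpose S)).2 h

omit [MonoidalClosed V] [HasLimits V] in
theorem whiskerRight_whiskerLeft_of_swapRight {X X' P Q Q' Y Y' : V} (m : Y ⟶ Y')
    {u : X ⊗ P ⟶ Q} {w : Q ⊗ Y' ⟶ Q'} {e : X ⊗ Y' ⟶ X'} {u' : X' ⊗ P ⟶ Q'}
    (h : u ▷ Y' ≫ w = swapRight X P Y' ≫ e ▷ P ≫ u') :
    u ▷ Y ≫ Q ◁ m ≫ w = swapRight X P Y ≫ (X ◁ m ≫ e) ▷ P ≫ u' := by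
  rw [← whisker_exchange_assoc, h, reassoc_of% swapRight_naturality_right (V := V),
    comp_whiskerRight_assoc]

/-- Naturality of the units in `F`, restricted along the transpose, is naturality in `a`. It is
needed to assemble the pointwise units into arrows of `[A, V]`. -/
theorem IsColimitFunctor.isNatFamily_transpose {L : Type w} [EnrichedCategory V L] [IsSmall V L]
    {φ : EnrichedFunctor V Lᵒᵖ V} {W : EnrichedFunctor V (EnrichedFunctor V L V) V}
    {η : ∀ (F : EnrichedFunctor V L V) (k : Lᵒᵖ),
      φ.obj k ⟶ (EnrichedCategory.Hom (F.obj k.unop) (W.obj F) : V)}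
    (h : IsColimitFunctor φ W η) (S : EnrichedFunctor V L (EnrichedFunctor V A V)) (k : Lᵒᵖ) :
    IsNatFamily V (S.obj k.unop) ((transpose S).comp V W)
      fun a => η ((transpose S).obj a) k := by
  have hk : ∀ F G : EnrichedFunctor V L V,
      MonoidalClosed.uncurry (η F k) ▷ (F ⟶[V] G) ≫ act W F G =
        swapRight (F.obj k.unop) (φ.obj k) (F ⟶[V] G) ≫ evalAct k.unop F G ▷ φ.obj k ≫
          MonoidalClosed.uncurry (η G k) :=
    (isNatFamily_iff_act (F := evalFunctor k.unop) (fun F => η F k)).1 (h.natural k)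
  refine (isNatFamily_iff_act (G := (transpose S).comp V W)
    (fun a => η ((transpose S).obj a) k)).2 fun a b => ?_
  refine (congrArg (MonoidalClosed.uncurry (η ((transpose S).obj a) k) ▷ (a ⟶[V] b) ≫ ·)
    (act_comp (transpose S) W a b)).trans ?_
  refine (whiskerRight_whiskerLeft_of_swapRight ((transpose S).map a b)
    (hk ((transpose S).obj a) ((transpose S).obj b))).trans ?_
  exact congrArg (fun m => swapRight _ _ _ ≫ m ▷ φ.obj k ≫
    MonoidalClosed.uncurry (η ((transpose S).obj b) k)) (whiskerLeft_transpose_map S a b k.unop)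

/-- The colimits of continuous functors by a flat weight are computed pointwise, and they are
continuous. -/
theorem exists_isWeightedColimit_flatWeights {L : Type w} [EnrichedCategory V L] [IsSmall V L]
    {φ : EnrichedFunctor V Lᵒᵖ V} (hφ : flatWeights Φ L φ)
    (S : EnrichedFunctor V L (EnrichedFunctor V A V)) (hS : ∀ k, IsContinuous Φ (S.obj k)) :
    ∃ (C : EnrichedFunctor V A V) (η : ∀ k : Lᵒᵖ, φ.obj k ⟶ (S.obj k.unop ⟶[V] C)),
      IsWeightedColimit φ S C η ∧ IsContinuous Φ C := by
  obtain ⟨W, η, hη, hW⟩ := hφ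
  exact ⟨_, _, isWeightedColimit_of_pointwise (fun a k => η ((transpose S).obj a) k)
    (fun a => hη.isColimit _) (hη.isNatFamily_transpose S), hW.transpose_comp hS⟩

theorem closedUnderColimits_isContinuous :
    ClosedUnderColimits (flatWeights Φ) fun F : EnrichedFunctor V A V => IsContinuous Φ F := by
  intro L _ _ φ hφ S c η hS hc
  obtain ⟨C, η', hC, hC'⟩ := exists_isWeightedColimit_flatWeights hφ S hS
  exact hC'.of_objIso (hC.objIso hc)

end Continuous

theorem isReflection_eId {V : Type v} [Category.{u} V] [MonoidalCategory V] {A : Type u₁}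
    [EnrichedCategory V A] {P : A → Prop} {a : A} (h : P a) :
    IsReflection P a a (eId V a) :=
  ⟨h, fun c _ => by rw [precomp_eId]; infer_instance⟩

/-! ### The closure under colimits -/

section Closure

variable {V : Type v} [Category.{u} V] [MonoidalCategory V] [SymmetricCategory V]
  [MonoidalClosed V] {Φ : WeightClass.{u, v, w} V} {A : Type u₁} [EnrichedCategory V A]
  {P : A → Prop}

theorem colimitClosure_of_mem {a : A} (h : P a) : colimitClosure Φ P a :=
  fun _ _ hP _ => hP a h

theorem colimitClosure_of_objIso {a b : A} (h : colimitClosure Φ P a) (e : ObjIso V a b) :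
    colimitClosure Φ P b :=
  fun Q hr hP hc => hr a b e (h Q hr hP hc)

theorem closedUnderColimits_colimitClosure : ClosedUnderColimits Φ (colimitClosure Φ P) :=
  fun K _ _ φ hφ S c η hS hc Q hr hP hQ => hQ K φ hφ S c η (fun k => hS k Q hr hP hQ) hc

end Closure

/-! ### Reflections into the continuous functors -/

section Reflections

variable {V : Type v} [Category.{u} V] [MonoidalCategory V] [SymmetricCategory V]
  [MonoidalClosed V] [HasLimits V] {Φ : WeightClass.{u, v, w} V}
  {N : Type w} [EnrichedCategory V N] [IsSmall V N]

theorem isContinuous_of_freeCocompletion {F : EnrichedFunctor V Nᵒᵖ V}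
    (hF : freeCocompletion (flatWeights Φ) N F) : IsContinuous Φ F := by
  refine hF _ (fun _ _ e h => h.of_objIso e) ?_ closedUnderColimits_isContinuous
  rintro _ ⟨n, rfl⟩
  exact isContinuous_homFunctor _

/-- The objects of `Φ(N)` have representable reflections into the continuous functors. -/
theorem exists_isReflection_representable (hN : IsCocomplete Φ N) {F : EnrichedFunctor V Nᵒᵖ V}
    (hF : freeCocompletion Φ N F) :
    ∃ (n : N) (r : 𝟙_ V ⟶ (F ⟶[V] representable n)),
      IsReflection (IsContinuous Φ) F (representable n) r := by
  refine hF (fun F => ∃ (n : N) (r : 𝟙_ V ⟶ (F ⟶[V] representable n)),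
    IsReflection (IsContinuous Φ) F (representable n) r) ?_ ?_ ?_
  · rintro F G e ⟨n, r, hr⟩
    exact ⟨n, hr.of_objIso e⟩
  · rintro _ ⟨n, rfl⟩
    exact ⟨n, _, isReflection_eId (isContinuous_homFunctor _)⟩
  · intro K _ _ φ hφ S c η hS hc
    choose d r hr using hS
    -- Representables are continuous, so the reflections can be tested against each other. By full
    -- faithfulness they form a diagram in `N` itself.
    obtain ⟨R, h₁, h₂, h₃⟩ := exists_reflect (y := yonedaFunctor) S r isIso_yonedaFunctor_map
      fun k _ => (hr k).isIso _ (isContinuous_homFunctor _)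
    let R' : EnrichedFunctor V K N := ⟨d, R, h₁, h₂⟩
    obtain ⟨m, ν, hν⟩ := hN K φ hφ R'
    have hν' := (isWeightedLimit_iff.1 hν).1
    obtain ⟨s, hs⟩ := hc.exists_isIso_precomp (R := R'.comp V yonedaFunctor)
      (d := yonedaFunctor.obj m) (η' := fun k => ν k ≫ yonedaFunctor.map (d k.unop) m) r
      (fun i j => (Category.assoc _ _ _).trans (h₃ i j)) (hν'.comp (opFunctor V yonedaFunctor))
    refine ⟨m, s, isContinuous_homFunctor _, fun H hH => hs H (fun k => (hr k).isIso H hH) ?_⟩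
    -- The cylinder `ν` is a `Φ`-limit in `Nᵒᵖ`, so a continuous `H` preserves it and sees the
    -- representable at `m` as a colimit.
    exact preservesCylinder_yonedaFunctor (isContinuous_iff.1 hH K φ hφ _ _ _ hν)

/-- The objects with a reflection in `Φ⁺(N)` include `Φ(N)`, whose reflections are representable.
They are closed under flat colimits, since the flat colimit of the reflections is continuous and
remains in `Φ⁺(N)`. -/
theorem exists_isReflection (hN : IsCocomplete Φ N) {F : EnrichedFunctor V Nᵒᵖ V}
    (hF : colimitClosure (flatWeights Φ) (freeCocompletion Φ N) F) :
    ∃ (G : EnrichedFunctor V Nᵒᵖ V) (r : 𝟙_ V ⟶ (F ⟶[V] G)),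
      IsReflection (IsContinuous Φ) F G r ∧ freeCocompletion (flatWeights Φ) N G := by
  refine hF (fun F => ∃ (G : EnrichedFunctor V Nᵒᵖ V) (r : 𝟙_ V ⟶ (F ⟶[V] G)),
    IsReflection (IsContinuous Φ) F G r ∧ freeCocompletion (flatWeights Φ) N G) ?_ ?_ ?_
  · rintro F F' e ⟨G, r, hr, hG⟩
    obtain ⟨r', hr'⟩ := hr.of_objIso e
    exact ⟨G, r', hr', hG⟩
  · intro F hF
    obtain ⟨n, r, hr⟩ := exists_isReflection_representable hN hF
    exact ⟨_, r, hr, colimitClosure_of_mem ⟨n, rfl⟩⟩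
  · intro K _ _ φ hφ S c η hS hc
    choose d r hr hd using hS
    -- The reflections need not be representable here, so the diagram is formed in `[Nᵒᵖ, V]` with
    -- the identity as the fully faithful functor.
    obtain ⟨R, h₁, h₂, h₃⟩ := exists_reflect (y := EnrichedFunctor.id V _) S r
      (fun a b => by dsimp only [EnrichedFunctor.id]; infer_instance)
      fun k k' => (hr k).isIso _ (hr k').mem
    let R' : EnrichedFunctor V K (EnrichedFunctor V Nᵒᵖ V) := ⟨d, R, h₁, h₂⟩
    obtain ⟨C, ν, hν, hC⟩ := exists_isWeightedColimit_flatWeights hφ R' fun k => (hr k).mem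
    obtain ⟨hν₁, hν₂⟩ := isWeightedLimit_iff.1 hν
    obtain ⟨s, hs⟩ := hc.exists_isIso_precomp (R := R') r
      (fun i j => (congrArg (R i j ≫ ·) (Category.id_comp _)).symm.trans (h₃ i j)) hν₁
    -- In this case `C` is a genuine colimit in `[Nᵒᵖ, V]`, so every `H` sees it as one; continuity
    -- of `H` serves only for the orthogonality to the units `r k`.
    exact ⟨C, s, ⟨hC, fun H hH => hs H (fun k => (hr k).isIso H hH) (hν₂ (op H))⟩,
      closedUnderColimits_colimitClosure K φ hφ R' C ν hd hν⟩

end Reflections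

end EnrichedFlat

end

theorem proposition8 {V : Type v} [Category.{u} V] [MonoidalCategory V] [SymmetricCategory V]
    [MonoidalClosed V] [HasLimits V] [HasColimits V] (Φ : WeightClass.{u, v, w} V)
    {N : Type w} [EnrichedCategory V N] [IsSmall V N] (hN : IsCocomplete Φ N) :
    ClosedUnderLimits (allWeights.{u, v, w} V)
      (fun F : EnrichedFunctor V Nᵒᵖ V => IsContinuous Φ F) ∧
    ClosedUnderColimits (flatWeights Φ)
      (fun F : EnrichedFunctor V Nᵒᵖ V => IsContinuous Φ F) ∧
    (∀ F : EnrichedFunctor V Nᵒᵖ V,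
      freeCocompletion (flatWeights Φ) N F → IsContinuous Φ F) ∧
    (∀ F : EnrichedFunctor V Nᵒᵖ V, colimitClosure (flatWeights Φ) (freeCocompletion Φ N) F →
      (∃ (G : EnrichedFunctor V Nᵒᵖ V) (r : 𝟙_ V ⟶ (F ⟶[V] G)),
        IsReflection (IsContinuous Φ) F G r) ∧
      ∀ (G : EnrichedFunctor V Nᵒᵖ V) (r : 𝟙_ V ⟶ (F ⟶[V] G)),
        IsReflection (IsContinuous Φ) F G r → freeCocompletion (flatWeights Φ) N G) ∧
    (∀ F : EnrichedFunctor V Nᵒᵖ V, freeCocompletion Φ N F →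
      ∀ (G : EnrichedFunctor V Nᵒᵖ V) (r : 𝟙_ V ⟶ (F ⟶[V] G)),
        IsReflection (IsContinuous Φ) F G r → ∃ n : N, ObjIso V G (representable n)) := by
  refine ⟨closedUnderLimits_isContinuous _, closedUnderColimits_isContinuous,
    fun F => isContinuous_of_freeCocompletion, fun F hF => ?_, fun F hF G r hr => ?_⟩
  · obtain ⟨G, r, hr, hG⟩ := exists_isReflection hN hF
    -- Reflections are unique up to isomorphism and the closure is replete, so the conclusion holds
    -- for every reflection of `F`.
    exact ⟨⟨G, r, hr⟩, fun G' r' hr' => colimitClosure_of_objIso hG (hr.objIso hr')⟩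
  · obtain ⟨n, s, hs⟩ := exists_isReflection_representable hN hF
    exact ⟨n, hr.objIso hs⟩
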